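/- \textbf{Setting.} Fix a set of function symbols, each with a type $\tau_1,\dots,\tau_k\to\sigma$, where types are $\mathsf{Str}[p]$ ($p$ a polynomial with natural coefficients; values of size parameter $n$ are the bit strings of length $p(n)$) and $\mathsf{Bool}$ (one bit); each symbol is interpreted by a deterministic, respectively randomized, polynomial time algorithm that takes $1^n$ and arguments of types $\tau_i$ to a value of type $\sigma$, respectively a distribution on such values. An environment $\Delta$ is a partial function with finite domain from variables to types; $\Xi\sqsubseteq\Delta$ means that $\Delta$ extends $\Xi$, and $\Xi\uplus\Theta$ is the union of environments with disjoint domains. A store over $\Delta$, $R\in[\![\Delta]\!]$, is a family $R=\{R_n\}_n$ of distributions on the well-typed memories $m$ with domain $\mathrm{dom}(\Delta)$ that is samplable by one probabilistic polynomial time (PPT) algorithm on input $1^n$. For $\Xi\sqsubseteq\Delta$, $R_{\Delta\to\Xi}$ is the marginal of $R$ on $\mathrm{dom}(\Xi)$, and $Q\sqsubseteq R$ means $Q=R_{\Delta\to\Xi}$. $R\approx Q$ is computational indistinguishability (every PPT distinguisher given $1^n$ and a sample has negligible advantage) of families with values in the same sets, and $\otimes$ is the product of stores over environments with disjoint domains.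 Deterministic expressions are $d::=r\mid g(d_1,\dots,d_k)$ with $g$ deterministic, and expressions are $e::=d\mid f(e_1,\dots,e_k)$ with $f$ randomized. Programs are $P::=\mathsf{skip}\mid r\leftarrow e\mid P;P\mid \mathsf{if}\ r\ \mathsf{then}\ P\ \mathsf{else}\ P$, with the usual typing $\Delta\vdash P$ and the usual probabilistic semantics $[\![P]\!]$ on stores over $\Delta$; $\mathrm{mv}(P)$ is the set of variables assigned to in $P$. Formulas $\phi^\Delta$ over $\Delta$ are: the well-typed atoms $\mathbf U(e)$, $e\approx g$, $e\sim g$, $d=c$; $\top$; $\bot$; $(\phi^\Xi*\psi^\Theta)^\Delta$ where $\mathrm{dom}(\Xi)\cap\mathrm{dom}(\Theta)=\emptyset$ and $\Xi\uplus\Theta\sqsubseteq\Delta$; and $(\phi^\Xi\wedge\psi^\Theta)^\Delta$ where $\Xi\sqsubseteq\Delta$, $\Theta\sqsubseteq\Delta$. A store $R$ over $\Delta$ satisfies $\mathbf U(e)$ if $[\![e]\!](R)$ is indistinguishable from the uniform family; $e\approx g$ (resp. $e\sim g$) if $[\![e]\!](R)$ and $[\![g]\!](R)$ are indistinguishable (resp.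 equal); $d=c$ if $d$ and $c$ have the same value on every memory in the support of every $R_n$; $\top$ always; $\bot$ never; $(\phi^\Xi\wedge\psi^\Theta)^\Delta$ if there are stores $Q\sqsubseteq R$ over $\Xi$ and $T\sqsubseteq R$ over $\Theta$ satisfying $\phi^\Xi$ and $\psi^\Theta$; $(\phi^\Xi*\psi^\Theta)^\Delta$ if there are stores $Q$ over $\Xi$ and $T$ over $\Theta$ satisfying $\phi^\Xi$ and $\psi^\Theta$ and a store $U\sqsubseteq R$ over $\Xi\uplus\Theta$ with $Q\otimes T\approx U$. $\phi^\Delta\models\psi^\Delta$ means that all stores over $\Delta$ satisfying $\phi^\Delta$ satisfy $\psi^\Delta$. The relation $\phi^\Delta\sqsubseteq\psi^\Xi$ is generated by: $A^\Delta\sqsubseteq A^\Xi$ if $\Delta\sqsubseteq\Xi$, for $A$ an atom, $\top$ or $\bot$; $(\phi^\Delta*\psi^\Xi)^{\Theta_1}\sqsubseteq(\phi^\Delta*\psi^\Xi)^{\Theta_2}$ if $\Theta_1\sqsubseteq\Theta_2$; and $(\phi_1^{\Delta_1}\wedge\psi_1^{\Xi_1})^{\Theta_1}\sqsubseteq(\phi_2^{\Delta_2}\wedge\psi_2^{\Xi_2})^{\Theta_2}$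 if $\phi_1^{\Delta_1}\sqsubseteq\phi_2^{\Delta_2}$, $\psi_1^{\Xi_1}\sqsubseteq\psi_2^{\Xi_2}$ and $\Theta_1\sqsubseteq\Theta_2$. The triple $\{\phi^\Delta\}\,\Delta\vdash P\,\{\psi^\Delta\}$ is \emph{valid} if $\Delta\vdash P$ and, for every store $R$ over $\Delta$ that satisfies $\phi^\Delta$, $[\![P]\!](R)$ is a store over $\Delta$ that satisfies $\psi^\Delta$. \textbf{Proposition (soundness of the structural rules).} The following rules preserve validity, for all environments, programs and formulas for which they make sense. \begin{itemize} \item (Weak) If $\{\xi^\Delta\}\,\Delta\vdash P\,\{\eta^\Delta\}$ is valid, $\phi^\Delta\models\xi^\Delta$ and $\eta^\Delta\models\psi^\Delta$, then $\{\phi^\Delta\}\,\Delta\vdash P\,\{\psi^\Delta\}$ is valid. \item (Const) If $\{\phi^\Xi\}\,\Xi\vdash P\,\{\psi^\Xi\}$ is valid, $\mathrm{dom}(\Theta)\cap\mathrm{mv}(P)=\emptyset$, $\Xi\sqsubseteq\Delta$ and $\Theta\sqsubseteq\Delta$, then $\{(\phi^\Xi\wedge\xi^\Theta)^\Delta\}\,\Delta\vdash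 P\,\{(\psi^\Xi\wedge\xi^\Theta)^\Delta\}$ is valid. \item (Frame) If $\{\phi^\Xi\}\,\Xi\vdash P\,\{\psi^\Xi\}$ is valid, $\mathrm{dom}(\Xi)\cap\mathrm{dom}(\Theta)=\emptyset$ and $\Xi\uplus\Theta\sqsubseteq\Delta$, then $\{(\phi^\Xi*\xi^\Theta)^\Delta\}\,\Delta\vdash P\,\{(\psi^\Xi*\xi^\Theta)^\Delta\}$ is valid. \item (Restr) If $\{\phi_1^\Xi\}\,\Xi\vdash P\,\{\psi_1^\Xi\}$ is valid, $\phi_1^\Xi\sqsubseteq\phi_2^\Delta$ and $\psi_1^\Xi\sqsubseteq\psi_2^\Delta$, then $\{\phi_2^\Delta\}\,\Delta\vdash P\,\{\psi_2^\Delta\}$ is valid. \end{itemize} -/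

import Mathlib

open Filter

noncomputable section

namespace CSL

/-! ## Probabilistic algorithms: a machine model with a step count

A machine has registers indexed by `ℕ`, each holding a stack of bits, and a finite structured
control program. Every primitive step costs one time unit and touches the top of at most one
stack, so this is a multi-stack (equivalently, multi-tape Turing) machine with coin tosses. -/

/-- Finite tuples of bit strings, padded by the empty string; also the register contents. -/
abbrev Tuple := ℕ → List Bool

inductive Instr : Type
  | skip : Instr
  /-- push a bit on a register -/
  | push : ℕ → Bool → Instr
  /-- remove the top bit of a register -/
  | pop : ℕ → Instr
  /-- push a fair random bit on a register -/
  | flip : ℕ → Instr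
  | seq : Instr → Instr → Instr
  /-- `case r a b c` runs `a`, `b`, `c` if register `r` is empty, has top `1`, has top `0` -/
  | case : ℕ → Instr → Instr → Instr → Instr
  /-- `loop r a` runs `a` as long as register `r` is not empty -/
  | loop : ℕ → Instr → Instr

/-- Programs without coin tosses. -/
def Instr.FlipFree : Instr → Prop
  | .skip => True
  | .push _ _ => True
  | .pop _ => True
  | .flip _ => False
  | .seq a b => a.FlipFree ∧ b.FlipFree
  | .case _ a b c => a.FlipFree ∧ b.FlipFree ∧ c.FlipFree
  | .loop _ a => a.FlipFree

/-- A configuration: what remains to be executed, and the contents of the registers. The machine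
has halted when nothing remains. -/
abbrev Config := List Instr × Tuple

/-- One step of computation. -/
def step : Config → PMF Config
  | ([], s) => PMF.pure ([], s)
  | (.skip :: k, s) => PMF.pure (k, s)
  | (.push r b :: k, s) => PMF.pure (k, Function.update s r (b :: s r))
  | (.pop r :: k, s) => PMF.pure (k, Function.update s r (s r).tail)
  | (.flip r :: k, s) =>
      (PMF.uniformOfFintype Bool).map fun b => (k, Function.update s r (b :: s r))
  | (.seq a b :: k, s) => PMF.pure (a :: b :: k, s)
  | (.case r a b c :: k, s) =>
      PMF.pure ((match s r with
        | [] => a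
        | true :: _ => b
        | false :: _ => c) :: k, s)
  | (.loop r a :: k, s) => PMF.pure (if s r = [] then k else a :: .loop r a :: k, s)

/-- The distribution of the configuration after `t` steps. -/
def runSteps : ℕ → Config → PMF Config
  | 0, c => PMF.pure c
  | t + 1, c => (step c).bind (runSteps t)

/-- Initial registers on input `(1ⁿ, v)`: register `0` (the output register) is empty, register `1`
holds `1ⁿ`, register `i + 2` holds the `i`-th component of `v`. -/
def initRegs (n : ℕ) (v : Tuple) : Tuple
  | 0 => []
  | 1 => List.replicate n true
  | i + 2 => v i

/-- Probabilistic polynomial time algorithms taking as input `1ⁿ` and an element `x ∈ X n` (given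
as a tuple of bit strings by `code`): on all such inputs, and for all outcomes of the coin tosses,
the program halts within `time n` steps. As `1ⁿ` is an input, a bound on inputs in `X n` costs
nothing: a program can always be stopped after `time n` steps. -/
structure PPT {α : Type} (code : α → Tuple) (X : ℕ → Set α) where
  prog : Instr
  time : Polynomial ℕ
  halts : ∀ n, ∀ x ∈ X n,
    ∀ c ∈ (runSteps (time.eval n) ([prog], initRegs n (code x))).support, c.1 = []

/-- Distribution of the final registers on input `(1ⁿ, x)`. -/
def PPT.out {α : Type} {code : α → Tuple} {X : ℕ → Set α} (A : PPT code X) (n : ℕ) (x : α) :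
    PMF Tuple :=
  (runSteps (A.time.eval n) ([A.prog], initRegs n (code x))).map Prod.snd

/-- Distribution of the contents of the output register on input `(1ⁿ, x)`. -/
def PPT.value {α : Type} {code : α → Tuple} {X : ℕ → Set α} (A : PPT code X) (n : ℕ) (x : α) :
    PMF (List Bool) :=
  (A.out n x).map fun s => s 0

/-- A single bit string, as a tuple. -/
def single (x : List Bool) : Tuple
  | 0 => x
  | _ + 1 => []

/-- A `k`-tuple of bit strings, as a padded tuple. -/
def pad {k : ℕ} (a : Fin k → List Bool) : Tuple :=
  fun i => if h : i < k then a ⟨i, h⟩ else []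

/-! ## Computational indistinguishability -/

def Negligible (ν : ℕ → ℝ) : Prop :=
  ∀ k : ℕ, ∀ᶠ n : ℕ in atTop, ν n ≤ 1 / (n : ℝ) ^ k

/-- Computational indistinguishability of two families of distributions, the `n`-th members of
which are distributions on `X n`. -/
def Indist {α : Type} (code : α → Tuple) (X : ℕ → Set α) (D E : ℕ → PMF α) : Prop :=
  ∀ A : PPT code X, ∃ ν : ℕ → ℝ, Negligible ν ∧ ∀ n,
    |(((D n).bind (A.value n)) [true]).toReal - (((E n).bind (A.value n)) [true]).toReal| ≤ ν n

/-! ## Types, environments, memories, stores -/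

inductive Ty : Type
  | str : Polynomial ℕ → Ty
  | bool : Ty

/-- The length of the values of a type; Booleans are strings of length one. -/
def Ty.len : Ty → ℕ → ℕ
  | .str p, n => p.eval n
  | .bool, _ => 1

def Ty.den (τ : Ty) (n : ℕ) : Set (List Bool) := {x | x.length = τ.len n}

/-- The family of uniform distributions on the values of a type. -/
def Ty.unif (τ : Ty) (n : ℕ) : PMF (List Bool) :=
  (PMF.uniformOfFintype (Fin (τ.len n) → Bool)).map List.ofFn

/-- Program variables. -/
abbrev Var := ℕ

/-- Environments: partial functions from variables to types with finite domain. -/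
structure Env where
  ty : Var → Option Ty
  finite : {r | ty r ≠ none}.Finite

def Env.dom (Δ : Env) : Set Var := {r | Δ.ty r ≠ none}

/-- Extension of environments. -/
instance : LE Env := ⟨fun Ξ Δ => ∀ r τ, Ξ.ty r = some τ → Δ.ty r = some τ⟩

/-- The union of two environments, used when their domains are disjoint. -/
def Env.join (Ξ Θ : Env) : Env where
  ty r := (Ξ.ty r).orElse fun _ => Θ.ty r
  finite := by
    refine (Ξ.finite.union Θ.finite).subset fun r hr => ?_
    cases h : Ξ.ty r with
    | none => exact Or.inr (by simpa [h] using hr)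
    | some τ => exact Or.inl (by simp [h])

/-- Memories. A memory with domain `dom Δ` is represented by its extension by the empty string
outside of `dom Δ`. -/
abbrev Mem := Var → List Bool

/-- The well-typed memories for an environment. -/
def Env.mems (Δ : Env) (n : ℕ) : Set Mem :=
  {m | (∀ r τ, Δ.ty r = some τ → m r ∈ τ.den n) ∧ ∀ r, Δ.ty r = none → m r = []}

/-- Restriction of a memory to the domain of an environment. -/
def Mem.restrict (Ξ : Env) (m : Mem) : Mem := fun r => if (Ξ.ty r).isSome then m r else []

/-- The memory that is `a` on the domain of `Ξ`, and `b` elsewhere. -/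
def Mem.join (Ξ : Env) (a b : Mem) : Mem := fun r => if (Ξ.ty r).isSome then a r else b r

abbrev Ensemble := ℕ → PMF Mem

/-- Efficiently samplable families of distributions on memories with domain `dom Δ`: some
probabilistic polynomial time algorithm that is given `1ⁿ` only leaves a sample `m` of `R n` in the
registers `r + 2`, `r ∈ dom Δ`. -/
def Env.Samplable (Δ : Env) (R : Ensemble) : Prop :=
  ∃ A : PPT (fun _ : Unit => (fun _ => [] : Tuple)) (fun _ => Set.univ),
    ∀ n, R n = (A.out n ()).map fun s => Mem.restrict Δ fun r => s (r + 2)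

/-- The interpretation of an environment: the efficiently samplable distribution ensembles. An
element of `Δ.sem`, together with `Δ`, is a store. -/
def Env.sem (Δ : Env) : Set Ensemble :=
  {R | (∀ n, (R n).support ⊆ Δ.mems n) ∧ Δ.Samplable R}

/-- Projection of an ensemble on an environment. -/
def proj (Ξ : Env) (R : Ensemble) : Ensemble :=
  fun n => (R n).bind fun m => PMF.pure (Mem.restrict Ξ m)

/-- The store `(Q, Ξ)` is extended by the store `(R, Δ)`. -/
def StoreExt (Ξ : Env) (Q : Ensemble) (Δ : Env) (R : Ensemble) : Prop :=
  Ξ ≤ Δ ∧ Q = proj Ξ R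

/-- The tensor product of an ensemble for `Ξ` with an ensemble for an environment whose domain is
disjoint from that of `Ξ`: the two parts of the memory are sampled independently. -/
def tensor (Ξ : Env) (Q T : Ensemble) : Ensemble :=
  fun n => (Q n).bind fun a => (T n).bind fun b => PMF.pure (Mem.join Ξ a b)

/-- Computational indistinguishability of stores with environment `Δ`. -/
def Env.Indist (Δ : Env) (R Q : Ensemble) : Prop := CSL.Indist (fun m : Mem => m) Δ.mems R Q

/-- Computational indistinguishability of families of distributions on values of type `τ`. -/
def Ty.Indist (τ : Ty) (D E : ℕ → PMF (List Bool)) : Prop := CSL.Indist single τ.den D E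

/-! ## Expressions -/

/-- The admissible arguments of a function symbol. -/
def args {k : ℕ} (σ : Fin k → Ty) (n : ℕ) : Set (Fin k → List Bool) :=
  {a | ∀ i, a i ∈ (σ i).den n}

/-- The function symbols, with their types and their interpretation by (deterministic,
respectively randomized) polynomial time algorithms. -/
structure Signature where
  /-- deterministic function symbols -/
  DF : Type
  dArity : DF → ℕ
  dArg : (g : DF) → Fin (dArity g) → Ty
  dRes : DF → Ty
  dFun : (g : DF) → ℕ → (Fin (dArity g) → List Bool) → List Bool
  dFun_mem : ∀ g n, ∀ a ∈ args (dArg g) n, dFun g n a ∈ (dRes g).den n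
  dFun_poly : ∀ g, ∃ A : PPT pad (args (dArg g)), A.prog.FlipFree ∧
    ∀ n, ∀ a ∈ args (dArg g) n, A.value n a = PMF.pure (dFun g n a)
  /-- randomized function symbols -/
  RF : Type
  rArity : RF → ℕ
  rArg : (f : RF) → Fin (rArity f) → Ty
  rRes : RF → Ty
  rFun : (f : RF) → ℕ → (Fin (rArity f) → List Bool) → PMF (List Bool)
  rFun_mem : ∀ f n, ∀ a ∈ args (rArg f) n, (rFun f n a).support ⊆ (rRes f).den n
  rFun_poly : ∀ f, ∃ A : PPT pad (args (rArg f)),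
    ∀ n, ∀ a ∈ args (rArg f) n, A.value n a = rFun f n a

/-- Deterministic expressions. -/
inductive DExpr (S : Signature) : Type
  | var : Var → DExpr S
  | app : (g : S.DF) → (Fin (S.dArity g) → DExpr S) → DExpr S

/-- Expressions. -/
inductive Expr (S : Signature) : Type
  | det : DExpr S → Expr S
  | app : (f : S.RF) → (Fin (S.rArity f) → Expr S) → Expr S

inductive DExpr.HasType {S : Signature} (Δ : Env) : DExpr S → Ty → Prop
  | var {r : Var} {τ : Ty} : Δ.ty r = some τ → HasType Δ (.var r) τ
  | app {g : S.DF} {d : Fin (S.dArity g) → DExpr S} :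
      (∀ i, HasType Δ (d i) (S.dArg g i)) → HasType Δ (.app g d) (S.dRes g)

inductive Expr.HasType {S : Signature} (Δ : Env) : Expr S → Ty → Prop
  | det {d : DExpr S} {τ : Ty} : d.HasType Δ τ → HasType Δ (.det d) τ
  | app {f : S.RF} {e : Fin (S.rArity f) → Expr S} :
      (∀ i, HasType Δ (e i) (S.rArg f i)) → HasType Δ (.app f e) (S.rRes f)

/-- The tensor product of finitely many distributions. -/
def pmfPi {α : Type} : {k : ℕ} → (Fin k → PMF α) → PMF (Fin k → α)
  | 0, _ => PMF.pure Fin.elim0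
  | _ + 1, D => (D 0).bind fun x =>
      (pmfPi fun i => D i.succ).bind fun xs => PMF.pure (Fin.cons x xs)

/-- The value of a deterministic expression in a memory. -/
def DExpr.val {S : Signature} : DExpr S → ℕ → Mem → List Bool
  | .var r, _, m => m r
  | .app g d, n, m => S.dFun g n fun i => (d i).val n m

/-- The distribution of the value of an expression in a memory. -/
def Expr.val {S : Signature} : Expr S → ℕ → Mem → PMF (List Bool)
  | .det d, n, m => PMF.pure (d.val n m)
  | .app f e, n, m => (pmfPi fun i => (e i).val n m).bind (S.rFun f n)

/-- The semantics of an expression on distribution ensembles. -/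
def Expr.sem {S : Signature} (e : Expr S) (R : Ensemble) : ℕ → PMF (List Bool) :=
  fun n => (R n).bind (e.val n)

/-! ## Programs -/

inductive Prog (S : Signature) : Type
  | skip : Prog S
  | assign : Var → Expr S → Prog S
  | seq : Prog S → Prog S → Prog S
  | ite : Var → Prog S → Prog S → Prog S

inductive Prog.Typed {S : Signature} (Δ : Env) : Prog S → Prop
  | skip : Typed Δ .skip
  | assign {r : Var} {e : Expr S} {τ : Ty} :
      Δ.ty r = some τ → e.HasType Δ τ → Typed Δ (.assign r e)
  | seq {P Q : Prog S} : Typed Δ P → Typed Δ Q → Typed Δ (.seq P Q)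
  | ite {r : Var} {P Q : Prog S} :
      Δ.ty r = some .bool → Typed Δ P → Typed Δ Q → Typed Δ (.ite r P Q)

def Prog.semN {S : Signature} : Prog S → ℕ → PMF Mem → PMF Mem
  | .skip, _, D => D
  | .assign r e, n, D =>
      D.bind fun m => (e.val n m).bind fun t => PMF.pure (Function.update m r t)
  | .seq P Q, n, D => Q.semN n (P.semN n D)
  | .ite r P Q, n, D =>
      D.bind fun m => if m r = [true] then P.semN n (PMF.pure m) else Q.semN n (PMF.pure m)

/-- The semantics of a program on distribution ensembles. -/
def Prog.sem {S : Signature} (P : Prog S) (R : Ensemble) : Ensemble := fun n => P.semN n (R n)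

/-- The variables modified by a program. -/
def Prog.mv {S : Signature} : Prog S → Set Var
  | .skip => ∅
  | .assign r _ => {r}
  | .seq P Q => P.mv ∪ Q.mv
  | .ite _ P Q => P.mv ∪ Q.mv

/-! ## Formulas -/

inductive Atom (S : Signature) : Type
  /-- pseudorandomness -/
  | ud : Expr S → Atom S
  /-- computational indistinguishability -/
  | indp : Expr S → Expr S → Atom S
  /-- equality of distributions -/
  | eq : Expr S → Expr S → Atom S
  /-- equality on all samples -/
  | espl : DExpr S → DExpr S → Atom S

inductive Atom.Typed {S : Signature} (Δ : Env) : Atom S → Prop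
  | ud {e : Expr S} {τ : Ty} : e.HasType Δ τ → Typed Δ (.ud e)
  | indp {e g : Expr S} {τ : Ty} : e.HasType Δ τ → g.HasType Δ τ → Typed Δ (.indp e g)
  | eq {e g : Expr S} {τ : Ty} : e.HasType Δ τ → g.HasType Δ τ → Typed Δ (.eq e g)
  | espl {d c : DExpr S} {τ : Ty} : d.HasType Δ τ → c.HasType Δ τ → Typed Δ (.espl d c)

/-- `Formula S Δ` is the set of formulas for the environment `Δ`. -/
inductive Formula (S : Signature) : Env → Type
  | atom {Δ : Env} (A : Atom S) : A.Typed Δ → Formula S Δ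
  | top {Δ : Env} : Formula S Δ
  | bot {Δ : Env} : Formula S Δ
  | sep {Ξ Θ Δ : Env} : Formula S Ξ → Formula S Θ →
      Disjoint Ξ.dom Θ.dom → Ξ.join Θ ≤ Δ → Formula S Δ
  | conj {Ξ Θ Δ : Env} : Formula S Ξ → Formula S Θ → Ξ ≤ Δ → Θ ≤ Δ → Formula S Δ

def Atom.Holds {S : Signature} (Δ : Env) : Atom S → Ensemble → Prop
  | .ud e, R => ∃ τ, e.HasType Δ τ ∧ τ.Indist (e.sem R) τ.unif
  | .indp e g, R => ∃ τ, e.HasType Δ τ ∧ g.HasType Δ τ ∧ τ.Indist (e.sem R) (g.sem R)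
  | .eq e g, R => e.sem R = g.sem R
  | .espl d c, R => ∀ n, ∀ m ∈ (R n).support, d.val n m = c.val n m

/-- Satisfaction of a formula for `Δ` by a store with environment `Δ`. -/
def Formula.Sat {S : Signature} : {Δ : Env} → Formula S Δ → Ensemble → Prop
  | Δ, .atom A _, R => A.Holds Δ R
  | _, .top, _ => True
  | _, .bot, _ => False
  | Δ, .sep (Ξ := Ξ) (Θ := Θ) φ ψ _ _, R =>
      ∃ Q ∈ Ξ.sem, ∃ T ∈ Θ.sem, ∃ U ∈ (Ξ.join Θ).sem,
        (Ξ.join Θ).Indist (tensor Ξ Q T) U ∧ StoreExt (Ξ.join Θ) U Δ R ∧ φ.Sat Q ∧ ψ.Sat T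
  | Δ, .conj (Ξ := Ξ) (Θ := Θ) φ ψ _ _, R =>
      ∃ Q ∈ Ξ.sem, ∃ T ∈ Θ.sem, StoreExt Ξ Q Δ R ∧ StoreExt Θ T Δ R ∧ φ.Sat Q ∧ ψ.Sat T

/-- Semantic entailment between formulas for `Δ`. -/
def Formula.Entails {S : Signature} {Δ : Env} (φ ψ : Formula S Δ) : Prop :=
  ∀ R ∈ Δ.sem, φ.Sat R → ψ.Sat R

/-- Extension of formulas: the same formula, up to larger environments. -/
inductive Formula.Ext {S : Signature} : {Δ Ξ : Env} → Formula S Δ → Formula S Ξ → Prop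
  | atom {Δ Ξ : Env} {A : Atom S} (hΔ : A.Typed Δ) (hΞ : A.Typed Ξ) :
      Δ ≤ Ξ → Ext (.atom A hΔ) (.atom A hΞ)
  | top {Δ Ξ : Env} : Δ ≤ Ξ → Ext (.top : Formula S Δ) (.top : Formula S Ξ)
  | bot {Δ Ξ : Env} : Δ ≤ Ξ → Ext (.bot : Formula S Δ) (.bot : Formula S Ξ)
  | sep {Δ Ξ Θ₁ Θ₂ : Env} {φ : Formula S Δ} {ψ : Formula S Ξ} (hd : Disjoint Δ.dom Ξ.dom)
      (h₁ : Δ.join Ξ ≤ Θ₁) (h₂ : Δ.join Ξ ≤ Θ₂) :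
      Θ₁ ≤ Θ₂ → Ext (.sep φ ψ hd h₁) (.sep φ ψ hd h₂)
  | conj {Δ₁ Δ₂ Ξ₁ Ξ₂ Θ₁ Θ₂ : Env} {φ₁ : Formula S Δ₁} {φ₂ : Formula S Δ₂}
      {ψ₁ : Formula S Ξ₁} {ψ₂ : Formula S Ξ₂}
      (h₁ : Δ₁ ≤ Θ₁) (k₁ : Ξ₁ ≤ Θ₁) (h₂ : Δ₂ ≤ Θ₂) (k₂ : Ξ₂ ≤ Θ₂) :
      Ext φ₁ φ₂ → Ext ψ₁ ψ₂ → Θ₁ ≤ Θ₂ → Ext (.conj φ₁ ψ₁ h₁ k₁) (.conj φ₂ ψ₂ h₂ k₂)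

/-- Validity of the Hoare triple `{φ} Δ ⊢ P {ψ}`: the program is well-typed, and it transforms
stores that satisfy `φ` into stores that satisfy `ψ`. That the result is again a store, i.e. that
it is efficiently samplable, is part of the claim. -/
def Valid {S : Signature} {Δ : Env} (φ : Formula S Δ) (P : Prog S) (ψ : Formula S Δ) : Prop :=
  P.Typed Δ ∧ ∀ R ∈ Δ.sem, φ.Sat R → P.sem R ∈ Δ.sem ∧ ψ.Sat (P.sem R)

end CSL

end

noncomputable section

namespace CSL

section

/-! ## Distributions -/

/-! Weak is immediate. The other rules rest on two facts about a well-typed program: it is local,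
and it is efficient.

Locality: a program typed in `Ξ` neither reads nor writes anything outside `dom Ξ`
(`Prog.Typed.semN_join`). Hence its semantics commutes with projection to `Ξ`
(`Prog.Typed.proj_sem`) and with tensoring by an independent store (`Prog.Typed.tensor_sem`), and
the marginal on variables it does not assign is unchanged (`Prog.proj_sem_of_disjoint_mv`). This
gives Const. For Restr one also needs that the truth of a formula depends only on the projection of
the store to the smaller environment (`Formula.Ext.sat_iff`).

Efficiency: the semantics sends samplable ensembles to samplable ones (`Prog.Typed.sem_mem`) and
indistinguishable ensembles to indistinguishable ones (`Prog.Typed.indist_sem`). With locality this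
gives Frame: if `Q ⊗ T ≈ U`, then `P(Q) ⊗ T = P(Q ⊗ T) ≈ P(U)`.

Both efficiency facts come from one compiler, `Layout.exists_implementation`, which turns a typed
program into a machine running in polynomial time on registers that hold the memory. Composing it
after a sampler gives a sampler; composing it before a distinguisher gives a distinguisher with the
same advantage. The remaining work is register bookkeeping: relocating given algorithms by an
injective renaming, and knowing which registers are still empty. -/

lemma bind_congr_support {α β : Type} (p : PMF α) {f g : α → PMF β}
    (h : ∀ a ∈ p.support, f a = g a) : p.bind f = p.bind g := by
  ext b
  simp only [PMF.bind_apply]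
  refine tsum_congr fun a => ?_
  by_cases ha : a ∈ p.support
  · rw [h a ha]
  · rw [PMF.mem_support_iff, not_not] at ha
    simp [ha]

lemma map_congr_support {α β : Type} (p : PMF α) {f g : α → β}
    (h : ∀ a ∈ p.support, f a = g a) : p.map f = p.map g :=
  bind_congr_support p fun a ha => by simp [h a ha]

lemma bind_eq_of_support {α β : Type} (p : PMF α) {f : α → PMF β} {q : PMF β}
    (h : ∀ a ∈ p.support, f a = q) : p.bind f = q := by
  rw [bind_congr_support p (g := fun _ => q) h, PMF.bind_const]

/-- Makes deterministic application a special case of the randomized one when expressions are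
compiled. -/
lemma pmfPi_pure {α : Type} : ∀ {k : ℕ} (a : Fin k → α),
    pmfPi (fun i => PMF.pure (a i)) = PMF.pure a
  | 0, a => by rw [pmfPi]; congr 1; exact Subsingleton.elim _ _
  | k + 1, a => by
      rw [pmfPi, PMF.pure_bind, pmfPi_pure fun i => a i.succ, PMF.pure_bind]
      congr 1
      exact Fin.cons_self_tail a

lemma mem_support_of_mem_support_pmfPi {α : Type} : ∀ {k : ℕ} {D : Fin k → PMF α} {a : Fin k → α},
    a ∈ (pmfPi D).support → ∀ i, a i ∈ (D i).support
  | 0, _, _, _, i => i.elim0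
  | k + 1, D, a, h, i => by
      rw [pmfPi] at h
      simp only [PMF.mem_support_bind_iff, PMF.mem_support_pure_iff] at h
      obtain ⟨x, hx, xs, hxs, rfl⟩ := h
      refine Fin.cases ?_ (fun j => ?_) i
      · simpa using hx
      · simpa using mem_support_of_mem_support_pmfPi hxs j

/-! ## Environments and memories -/

lemma Env.isSome_mono {Ξ Δ : Env} (h : Ξ ≤ Δ) {r : Var} (hr : (Ξ.ty r).isSome) :
    (Δ.ty r).isSome := by
  obtain ⟨τ, hτ⟩ := Option.isSome_iff_exists.1 hr
  simp [h r τ hτ]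

lemma Env.mem_dom {Δ : Env} {r : Var} : r ∈ Δ.dom ↔ (Δ.ty r).isSome := by
  simp [Env.dom, Option.isSome_iff_ne_none]

lemma Env.left_le_join (Ξ Θ : Env) : Ξ ≤ Ξ.join Θ := fun r τ h => by simp [Env.join, h]

lemma restrict_restrict {Ξ Δ : Env} (h : Ξ ≤ Δ) (m : Mem) :
    Mem.restrict Ξ (Mem.restrict Δ m) = Mem.restrict Ξ m := by
  funext r
  unfold Mem.restrict
  split_ifs with h1 h2
  · rfl
  · exact absurd (Env.isSome_mono h h1) h2
  · rfl

lemma restrict_eq_self {Δ : Env} {n : ℕ} {m : Mem} (hm : m ∈ Δ.mems n) :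
    Mem.restrict Δ m = m := by
  funext r
  unfold Mem.restrict
  split_ifs with h
  · rfl
  · exact (hm.2 r (by simpa using h)).symm

lemma restrict_mem_mems {Ξ Δ : Env} (h : Ξ ≤ Δ) {n : ℕ} {m : Mem} (hm : m ∈ Δ.mems n) :
    Mem.restrict Ξ m ∈ Ξ.mems n := by
  refine ⟨fun r τ hr => ?_, fun r hr => ?_⟩
  · simpa [Mem.restrict, hr] using hm.1 r τ (h r τ hr)
  · simp [Mem.restrict, hr]

lemma join_mem_mems {Ξ Θ : Env} {n : ℕ} {a b : Mem} (ha : a ∈ Ξ.mems n) (hb : b ∈ Θ.mems n) :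
    Mem.join Ξ a b ∈ (Ξ.join Θ).mems n := by
  refine ⟨fun r τ hr => ?_, fun r hr => ?_⟩ <;> cases h : Ξ.ty r with
  | none => simp_all [Mem.join, Env.join, Env.mems]
  | some σ => simp_all [Mem.join, Env.join, Env.mems]

lemma update_mem_mems {Δ : Env} {n : ℕ} {m : Mem} (hm : m ∈ Δ.mems n) {r : Var} {τ : Ty}
    (hr : Δ.ty r = some τ) {t : List Bool} (ht : t ∈ τ.den n) :
    Function.update m r t ∈ Δ.mems n := by
  refine ⟨fun r' σ h => ?_, fun r' h => ?_⟩
  · by_cases e : r' = r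
    · subst e
      obtain rfl : τ = σ := by simpa [hr] using h
      simpa using ht
    · simpa [e] using hm.1 r' σ h
  · have e : r' ≠ r := by rintro rfl; simp [hr] at h
    simpa [e] using hm.2 r' h

lemma proj_proj {Ξ Δ : Env} (h : Ξ ≤ Δ) (R : Ensemble) : proj Ξ (proj Δ R) = proj Ξ R := by
  funext n
  simp [proj, PMF.bind_bind, PMF.pure_bind, restrict_restrict h]

lemma proj_support_subset {Ξ Δ : Env} (h : Ξ ≤ Δ) {R : Ensemble} {n : ℕ}
    (hR : (R n).support ⊆ Δ.mems n) : (proj Ξ R n).support ⊆ Ξ.mems n := by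
  intro m hm
  simp only [proj, PMF.mem_support_bind_iff, PMF.mem_support_pure_iff] at hm
  obtain ⟨m', hm', rfl⟩ := hm
  exact restrict_mem_mems h (hR hm')

lemma tensor_support_subset {Ξ Θ : Env} {Q T : Ensemble} {n : ℕ}
    (hQ : (Q n).support ⊆ Ξ.mems n) (hT : (T n).support ⊆ Θ.mems n) :
    (tensor Ξ Q T n).support ⊆ (Ξ.join Θ).mems n := by
  intro m hm
  simp only [tensor, PMF.mem_support_bind_iff, PMF.mem_support_pure_iff] at hm
  obtain ⟨a, ha, b, hb, rfl⟩ := hm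
  exact join_mem_mems (hQ ha) (hT hb)

/-- The same sampler works: only fewer of its final registers are read off. -/
lemma proj_mem_sem {Ξ Δ : Env} (h : Ξ ≤ Δ) {R : Ensemble} (hR : R ∈ Δ.sem) :
    proj Ξ R ∈ Ξ.sem := by
  refine ⟨fun n => proj_support_subset h (hR.1 n), ?_⟩
  obtain ⟨A, hA⟩ := hR.2
  refine ⟨A, fun n => ?_⟩
  rw [proj, hA n]
  change PMF.map _ _ = _
  rw [PMF.map_comp]
  congr 1
  funext s
  exact restrict_restrict h _

/-! ## Typing -/

variable {S : Signature}

lemma DExpr.HasType.mono {Ξ Δ : Env} (h : Ξ ≤ Δ) {d : DExpr S} {τ : Ty} (hd : d.HasType Ξ τ) :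
    d.HasType Δ τ := by
  induction hd with
  | var hr => exact .var (h _ _ hr)
  | app _ ih => exact .app ih

lemma Expr.HasType.mono {Ξ Δ : Env} (h : Ξ ≤ Δ) {e : Expr S} {τ : Ty} (he : e.HasType Ξ τ) :
    e.HasType Δ τ := by
  induction he with
  | det hd => exact .det (hd.mono h)
  | app _ ih => exact .app ih

lemma Prog.Typed.mono {Ξ Δ : Env} (h : Ξ ≤ Δ) {P : Prog S} (hP : P.Typed Ξ) : P.Typed Δ := by
  induction hP with
  | skip => exact .skip
  | assign hr he => exact .assign (h _ _ hr) (he.mono h)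
  | seq _ _ ih₁ ih₂ => exact .seq ih₁ ih₂
  | ite hr _ _ ih₁ ih₂ => exact .ite (h _ _ hr) ih₁ ih₂

/-- Satisfaction of atoms quantifies existentially over the type; uniqueness lets a type found in a
large environment be used in a smaller one. -/
lemma DExpr.HasType.unique {Δ : Env} {d : DExpr S} {τ σ : Ty} (h : d.HasType Δ τ)
    (k : d.HasType Δ σ) : τ = σ := by
  cases h with
  | var h => cases k with
    | var k => simpa [h] using k
  | app _ => cases k; rfl

lemma Expr.HasType.unique {Δ : Env} {e : Expr S} {τ σ : Ty} (h : e.HasType Δ τ)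
    (k : e.HasType Δ σ) : τ = σ := by
  cases h with
  | det h => cases k with
    | det k => exact h.unique k
  | app _ => cases k; rfl

/-! ## Expressions -/

lemma DExpr.HasType.val_congr {Ξ : Env} {d : DExpr S} {τ : Ty} (hd : d.HasType Ξ τ) (n : ℕ)
    {m m' : Mem} (h : ∀ r, (Ξ.ty r).isSome → m r = m' r) : d.val n m = d.val n m' := by
  induction hd with
  | var hr => exact h _ (by simp [hr])
  | app _ ih => simp only [DExpr.val, ih]

lemma Expr.HasType.val_congr {Ξ : Env} {e : Expr S} {τ : Ty} (he : e.HasType Ξ τ) (n : ℕ)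
    {m m' : Mem} (h : ∀ r, (Ξ.ty r).isSome → m r = m' r) : e.val n m = e.val n m' := by
  induction he with
  | det hd => simp only [Expr.val, hd.val_congr n h]
  | app _ ih => simp only [Expr.val, ih]

lemma DExpr.HasType.val_mem {Δ : Env} {d : DExpr S} {τ : Ty} (hd : d.HasType Δ τ) {n : ℕ}
    {m : Mem} (hm : m ∈ Δ.mems n) : d.val n m ∈ τ.den n := by
  induction hd with
  | var hr => exact hm.1 _ _ hr
  | app _ ih => exact S.dFun_mem _ _ _ ih

lemma Expr.HasType.support_val_subset {Δ : Env} {e : Expr S} {τ : Ty} (he : e.HasType Δ τ)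
    {n : ℕ} {m : Mem} (hm : m ∈ Δ.mems n) : (e.val n m).support ⊆ τ.den n := by
  induction he with
  | det hd =>
    intro x hx
    rw [Expr.val, PMF.mem_support_pure_iff] at hx
    exact hx ▸ hd.val_mem hm
  | app _ ih =>
    intro x hx
    rw [Expr.val, PMF.mem_support_bind_iff] at hx
    obtain ⟨a, ha, hx⟩ := hx
    exact S.rFun_mem _ _ _ (fun i => ih i (mem_support_of_mem_support_pmfPi ha i)) hx

lemma Expr.HasType.sem_proj {Ξ : Env} {e : Expr S} {τ : Ty} (he : e.HasType Ξ τ) (R : Ensemble) :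
    e.sem (proj Ξ R) = e.sem R := by
  funext n
  simp only [Expr.sem, proj, PMF.bind_bind, PMF.pure_bind]
  congr 1
  funext m
  exact he.val_congr n fun r hr => by simp [Mem.restrict, hr]

/-! ## Programs -/

/-- Programs act as Kleisli maps, so identities about them need checking only on point masses. -/
lemma Prog.semN_bind (P : Prog S) (n : ℕ) (D : PMF Mem) :
    P.semN n D = D.bind fun m => P.semN n (PMF.pure m) := by
  induction P generalizing D with
  | skip => simp [Prog.semN]
  | assign r e => simp [Prog.semN]
  | seq P Q ihP ihQ =>
    simp only [Prog.semN]
    rw [ihQ, ihP, PMF.bind_bind]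
    congr 1
    funext m
    exact (ihQ _).symm
  | ite r P Q _ _ => simp [Prog.semN]

lemma Prog.Typed.support_semN_subset {Δ : Env} {P : Prog S} (hP : P.Typed Δ) {n : ℕ} {D : PMF Mem}
    (hD : D.support ⊆ Δ.mems n) : (P.semN n D).support ⊆ Δ.mems n := by
  induction hP generalizing D with
  | skip => exact hD
  | assign hr he =>
    intro x hx
    simp only [Prog.semN, PMF.mem_support_bind_iff, PMF.mem_support_pure_iff] at hx
    obtain ⟨m, hm, t, ht, rfl⟩ := hx
    exact update_mem_mems (hD hm) hr (he.support_val_subset (hD hm) ht)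
  | seq _ _ ih₁ ih₂ => exact ih₂ (ih₁ hD)
  | @ite r P Q hr _ _ ih₁ ih₂ =>
    intro x hx
    simp only [Prog.semN, PMF.mem_support_bind_iff] at hx
    obtain ⟨m, hm, hx⟩ := hx
    have hm' : (PMF.pure m).support ⊆ Δ.mems n := by
      rw [PMF.support_pure]
      exact Set.singleton_subset_iff.2 (hD hm)
    split_ifs at hx
    · exact ih₁ hm' hx
    · exact ih₂ hm' hx

/-- A program acts only on the part of the memory that its environment describes. -/
lemma Prog.Typed.semN_join {Ξ : Env} {P : Prog S} (hP : P.Typed Ξ) (n : ℕ) (a b : Mem) :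
    P.semN n (PMF.pure (Mem.join Ξ a b)) =
      (P.semN n (PMF.pure a)).map fun x => Mem.join Ξ x b := by
  induction hP generalizing a with
  | skip => simp [Prog.semN, PMF.pure_map]
  | @assign r e τ hr he =>
    simp only [Prog.semN, PMF.pure_bind, PMF.map_bind, PMF.pure_map]
    rw [he.val_congr n (m := Mem.join Ξ a b) (m' := a) fun r hr => by simp [Mem.join, hr]]
    congr 1
    funext t
    congr 1
    funext r'
    by_cases h : r' = r
    · subst h
      simp [Mem.join, hr]
    · simp [Mem.join, h]
  | @seq P Q _ _ ih₁ ih₂ =>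
    simp only [Prog.semN]
    rw [ih₁, Q.semN_bind, PMF.bind_map, Q.semN_bind n (P.semN n _), PMF.map_bind]
    congr 1
    funext x
    exact ih₂ x
  | @ite r P Q hr _ _ ih₁ ih₂ =>
    have h : Mem.join Ξ a b r = a r := by simp [Mem.join, hr]
    simp only [Prog.semN, PMF.pure_bind, h]
    split_ifs
    · exact ih₁ a
    · exact ih₂ a

lemma Prog.Typed.proj_sem {Ξ : Env} {P : Prog S} (hP : P.Typed Ξ) (R : Ensemble) :
    proj Ξ (P.sem R) = P.sem (proj Ξ R) := by
  funext n
  simp only [proj, Prog.sem]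
  rw [P.semN_bind n (R n), P.semN_bind n (PMF.bind _ _), PMF.bind_bind, PMF.bind_bind]
  congr 1
  funext m
  rw [PMF.pure_bind]
  -- Restriction to `Ξ` is `Mem.join Ξ` with the everywhere empty memory as second part.
  exact (hP.semN_join n m fun _ => []).symm

lemma Prog.Typed.tensor_sem {Ξ : Env} {P : Prog S} (hP : P.Typed Ξ) (Q T : Ensemble) :
    tensor Ξ (P.sem Q) T = P.sem (tensor Ξ Q T) := by
  funext n
  simp only [tensor, Prog.sem]
  rw [P.semN_bind n (Q n), P.semN_bind n (PMF.bind _ _), PMF.bind_bind, PMF.bind_bind]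
  congr 1
  funext a
  -- Independence of the two factors: the sample of `T` may be drawn before `P` is run.
  rw [PMF.bind_comm, PMF.bind_bind]
  congr 1
  funext b
  rw [PMF.pure_bind]
  exact (hP.semN_join n a b).symm

lemma Prog.eq_of_notMem_mv (P : Prog S) {n : ℕ} {m m' : Mem}
    (h : m' ∈ (P.semN n (PMF.pure m)).support) {r : Var} (hr : r ∉ P.mv) : m' r = m r := by
  induction P generalizing m m' with
  | skip =>
    rw [Prog.semN, PMF.mem_support_pure_iff] at h
    rw [h]
  | assign r' e =>
    simp only [Prog.semN, PMF.pure_bind, PMF.mem_support_bind_iff, PMF.mem_support_pure_iff] at h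
    obtain ⟨t, _, rfl⟩ := h
    exact Function.update_of_ne hr _ _
  | seq P Q ihP ihQ =>
    rw [Prog.semN, Q.semN_bind, PMF.mem_support_bind_iff] at h
    obtain ⟨x, hx, h⟩ := h
    exact (ihQ h fun k => hr (Or.inr k)).trans (ihP hx fun k => hr (Or.inl k))
  | ite r' P Q ihP ihQ =>
    rw [Prog.semN, PMF.pure_bind] at h
    split_ifs at h
    · exact ihP h fun k => hr (Or.inl k)
    · exact ihQ h fun k => hr (Or.inr k)

/-- For a fixed initial memory every possible final memory agrees with it on `Θ`, so the projected
outcome is a point mass however random `P` is. -/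
lemma Prog.proj_sem_of_disjoint_mv {Θ : Env} {P : Prog S} (h : Θ.dom ∩ P.mv = ∅) (R : Ensemble) :
    proj Θ (P.sem R) = proj Θ R := by
  funext n
  simp only [proj, Prog.sem]
  rw [P.semN_bind, PMF.bind_bind]
  congr 1
  funext m
  refine bind_eq_of_support _ fun m' hm' => ?_
  congr 1
  funext r
  unfold Mem.restrict
  split_ifs with hr
  · exact P.eq_of_notMem_mv hm' fun k =>
      (Set.eq_empty_iff_forall_notMem.1 h r) ⟨Env.mem_dom.2 hr, k⟩
  · rfl

/-! ## Formulas -/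

/-- Expressions typed in `Ξ` read only variables of `Ξ`, and their types do not change in `Δ`. -/
lemma Atom.holds_proj {Ξ Δ : Env} (h : Ξ ≤ Δ) {A : Atom S} (hA : A.Typed Ξ) (R : Ensemble) :
    A.Holds Δ R ↔ A.Holds Ξ (proj Ξ R) := by
  cases hA with
  | @ud e τ he =>
    simp only [Atom.Holds, he.sem_proj]
    constructor
    · rintro ⟨σ, hσ, k⟩
      obtain rfl := hσ.unique (he.mono h)
      exact ⟨_, he, k⟩
    · rintro ⟨σ, hσ, k⟩
      exact ⟨σ, hσ.mono h, k⟩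
  | @indp e g τ he hg =>
    simp only [Atom.Holds, he.sem_proj, hg.sem_proj]
    constructor
    · rintro ⟨σ, hσ, _, k⟩
      obtain rfl := hσ.unique (he.mono h)
      exact ⟨_, he, hg, k⟩
    · rintro ⟨σ, hσ, hσ', k⟩
      exact ⟨σ, hσ.mono h, hσ'.mono h, k⟩
  | @eq e g τ he hg => simp only [Atom.Holds, he.sem_proj, hg.sem_proj]
  | @espl d c τ hd hc =>
    have hv : ∀ {d : DExpr S} {τ}, d.HasType Ξ τ → ∀ n m, d.val n (Mem.restrict Ξ m) = d.val n m :=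
      fun hd n m => hd.val_congr n fun r hr => by simp [Mem.restrict, hr]
    simp only [Atom.Holds, proj, PMF.mem_support_bind_iff, PMF.mem_support_pure_iff]
    constructor
    · rintro k n _ ⟨m, hm, rfl⟩
      rw [hv hd, hv hc]
      exact k n m hm
    · intro k n m hm
      rw [← hv hd, ← hv hc]
      exact k n _ ⟨m, hm, rfl⟩

lemma Formula.Ext.le {Ξ Δ : Env} {φ : Formula S Ξ} {φ' : Formula S Δ} (h : φ.Ext φ') : Ξ ≤ Δ := by
  cases h <;> assumption

/-- Witnesses below `R` are forced to be projections of `R`, and projections compose. For `sep` the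
components do not change, so nothing recursive is needed. For `conj` they may grow, and samplability
of `R` is what makes the projections to the other environments legitimate witnesses. -/
lemma Formula.Ext.sat_iff {Ξ Δ : Env} {φ : Formula S Ξ} {φ' : Formula S Δ} (h : φ.Ext φ')
    {R : Ensemble} (hR : R ∈ Δ.sem) : φ'.Sat R ↔ φ.Sat (proj Ξ R) := by
  induction h generalizing R with
  | atom hΔ hΞ h => exact Atom.holds_proj h hΔ R
  | top h => exact Iff.rfl
  | bot h => exact Iff.rfl
  | sep hd h₁ h₂ h =>
    simp only [Formula.Sat, StoreExt, proj_proj h₁, h₁, h₂]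
  | @conj Δ₁ Δ₂ Ξ₁ Ξ₂ Θ₁ Θ₂ φ₁ φ₂ ψ₁ ψ₂ h₁ k₁ h₂ k₂ hφ hψ h ihφ ihψ =>
    simp only [Formula.Sat, StoreExt]
    constructor
    · rintro ⟨Q, hQ, T, hT, ⟨_, rfl⟩, ⟨_, rfl⟩, hφQ, hψT⟩
      rw [ihφ hQ, proj_proj hφ.le] at hφQ
      rw [ihψ hT, proj_proj hψ.le] at hψT
      have hR' := proj_mem_sem h hR
      refine ⟨_, proj_mem_sem h₁ hR', _, proj_mem_sem k₁ hR', ⟨h₁, rfl⟩, ⟨k₁, rfl⟩, ?_, ?_⟩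
      · rwa [proj_proj h₁]
      · rwa [proj_proj k₁]
    · rintro ⟨Q, hQ, T, hT, ⟨_, rfl⟩, ⟨_, rfl⟩, hφQ, hψT⟩
      rw [proj_proj h₁] at hφQ
      rw [proj_proj k₁] at hψT
      have hQ' := proj_mem_sem h₂ hR
      have hT' := proj_mem_sem k₂ hR
      refine ⟨_, hQ', _, hT', ⟨h₂, rfl⟩, ⟨k₂, rfl⟩, ?_, ?_⟩
      · rwa [ihφ hQ', proj_proj hφ.le]
      · rwa [ihψ hT', proj_proj hψ.le]

end

section

/-! ## Terminating runs -/

/-- Started with the instructions `l` and the registers `s`, the machine halts within `T` steps,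
with final registers distributed according to `D`. -/
def Runs (l : List Instr) (s : Tuple) (T : ℕ) (D : PMF Tuple) : Prop :=
  runSteps T (l, s) = D.map (Prod.mk [])

lemma runSteps_halted (T : ℕ) (s : Tuple) : runSteps T ([], s) = PMF.pure ([], s) := by
  induction T with
  | zero => rfl
  | succ T ih => rw [runSteps, step, PMF.pure_bind, ih]

lemma runSteps_add (a b : ℕ) (c : Config) :
    runSteps (a + b) c = (runSteps a c).bind (runSteps b) := by
  induction a generalizing c with
  | zero => rw [Nat.zero_add, runSteps, PMF.pure_bind]
  | succ a ih =>
    rw [Nat.succ_add, runSteps, runSteps, PMF.bind_bind]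
    congr 1
    funext c'
    exact ih c'

lemma runs_nil (T : ℕ) (s : Tuple) : Runs [] s T (PMF.pure s) := by
  rw [Runs, runSteps_halted, PMF.pure_map]

/-- Halted configurations are fixed by `step`, so time bounds can be rounded up freely. -/
lemma Runs.mono {l : List Instr} {s : Tuple} {T T' : ℕ} {D : PMF Tuple} (h : Runs l s T D)
    (hT : T ≤ T') : Runs l s T' D := by
  obtain ⟨d, rfl⟩ := Nat.exists_eq_add_of_le hT
  rw [Runs, runSteps_add, h, PMF.bind_map]
  change D.bind _ = D.bind _
  congr 1
  funext s'
  exact runSteps_halted d s'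

lemma runs_of_halts {l : List Instr} {s : Tuple} {T : ℕ}
    (h : ∀ c ∈ (runSteps T (l, s)).support, c.1 = []) :
    Runs l s T ((runSteps T (l, s)).map Prod.snd) := by
  rw [Runs, PMF.map_comp]
  conv_lhs => rw [← PMF.map_id (runSteps T (l, s))]
  refine map_congr_support _ fun c hc => ?_
  have := h c hc
  ext1
  · simpa using this
  · rfl

lemma Runs.halts {l : List Instr} {s : Tuple} {T : ℕ} {D : PMF Tuple} (h : Runs l s T D)
    {c : Config} (hc : c ∈ (runSteps T (l, s)).support) : c.1 = [] := by
  rw [h, PMF.mem_support_map_iff] at hc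
  obtain ⟨s', _, rfl⟩ := hc
  rfl

lemma Runs.map_snd {l : List Instr} {s : Tuple} {T : ℕ} {D : PMF Tuple} (h : Runs l s T D) :
    (runSteps T (l, s)).map Prod.snd = D := by
  rw [h, PMF.map_comp]
  exact PMF.map_id D

lemma PPT.runs {α : Type} {code : α → Tuple} {X : ℕ → Set α} (A : PPT code X) {n : ℕ} {x : α}
    (hx : x ∈ X n) :
    Runs [A.prog] (initRegs n (code x)) (A.time.eval n) (A.out n x) :=
  runs_of_halts (A.halts n x hx)

lemma Runs.of_step {i : Instr} {l l' : List Instr} {s s' : Tuple} {T : ℕ} {D : PMF Tuple}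
    (hs : step (i :: l, s) = PMF.pure (l', s')) (h : Runs l' s' T D) :
    Runs (i :: l) s (T + 1) D := by
  rw [Runs, runSteps, hs, PMF.pure_bind, h]

/-- A step inspects only the first pending instruction; the rest is carried along. A nonempty list
is essential, as otherwise `k` itself would start running. -/
lemma step_append (i : Instr) (l k : List Instr) (s : Tuple) :
    step (i :: l ++ k, s) = (step (i :: l, s)).map fun c => (c.1 ++ k, c.2) := by
  cases i with
  | flip r =>
    simp only [List.cons_append, step, PMF.map_comp]
    rfl
  | loop r a =>
    simp only [List.cons_append, step, PMF.pure_map]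
    split_ifs <;> simp
  | _ => simp [step, PMF.pure_map]

lemma Runs.append {l k : List Instr} {s : Tuple} {T T' : ℕ} {D : PMF Tuple} {F : Tuple → PMF Tuple}
    (h : Runs l s T D) (hk : ∀ s' ∈ D.support, Runs k s' T' (F s')) :
    Runs (l ++ k) s (T + T') (D.bind F) := by
  induction T generalizing l s D with
  | zero =>
    have h' := h
    rw [Runs, runSteps] at h'
    have hl : l = [] := h.halts (c := (l, s)) (by simp [runSteps])
    subst hl
    have hD : D = PMF.pure s := by rw [← h.map_snd, runSteps, PMF.pure_map]
    subst hD
    rw [PMF.pure_bind, Nat.zero_add, List.nil_append]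
    exact hk s (by simp)
  | succ T ih =>
    cases l with
    | nil =>
      have hD : D = PMF.pure s := by rw [← h.map_snd, runSteps_halted, PMF.pure_map]
      subst hD
      rw [PMF.pure_bind, List.nil_append]
      exact (hk s (by simp)).mono (by omega)
    | cons i l =>
      -- Every outcome of the first step halts within the remaining `T` steps, so `D` decomposes
      -- over these outcomes and the induction hypothesis applies to each.
      have hc : ∀ c ∈ (step (i :: l, s)).support,
          Runs c.1 c.2 T ((runSteps T c).map Prod.snd) := fun c hc =>
        runs_of_halts fun c' hc' => h.halts (by
          rw [runSteps, PMF.mem_support_bind_iff]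
          exact ⟨c, hc, hc'⟩)
      have hD : D = (step (i :: l, s)).bind fun c => (runSteps T c).map Prod.snd := by
        rw [← h.map_snd, runSteps, PMF.map_bind]
      rw [Runs, Nat.succ_add, runSteps, step_append, PMF.bind_map, hD, PMF.bind_bind, PMF.map_bind]
      refine bind_congr_support _ fun c hc' => ih (hc c hc') fun s' hs' => hk s' ?_
      rw [hD, PMF.mem_support_bind_iff]
      exact ⟨c, hc', hs'⟩

lemma Runs.cons {i : Instr} {k : List Instr} {s : Tuple} {T T' : ℕ} {D : PMF Tuple}
    {F : Tuple → PMF Tuple} (h : Runs [i] s T D) (hk : ∀ s' ∈ D.support, Runs k s' T' (F s')) :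
    Runs (i :: k) s (T + T') (D.bind F) :=
  Runs.append (l := [i]) h hk

lemma Runs.cons_pure {i : Instr} {k : List Instr} {s s' : Tuple} {T T' : ℕ} {D : PMF Tuple}
    (h : Runs [i] s T (PMF.pure s')) (hk : Runs k s' T' D) : Runs (i :: k) s (T + T') D := by
  have := h.cons (F := fun _ => D) (T' := T') (k := k) fun t ht => by
    rw [PMF.mem_support_pure_iff] at ht
    exact ht ▸ hk
  rwa [PMF.bind_const] at this

lemma Runs.seq {a b : Instr} {s : Tuple} {T T' : ℕ} {D : PMF Tuple}
    {F : Tuple → PMF Tuple} (h : Runs [a] s T D) (hk : ∀ s' ∈ D.support, Runs [b] s' T' (F s')) :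
    Runs [.seq a b] s (T + T' + 1) (D.bind F) :=
  Runs.of_step rfl (h.cons hk)

lemma Runs.seq_pure {a b : Instr} {s s' : Tuple} {T T' : ℕ} {D : PMF Tuple}
    (h : Runs [a] s T (PMF.pure s')) (hk : Runs [b] s' T' D) :
    Runs [.seq a b] s (T + T' + 1) D :=
  Runs.of_step rfl (h.cons_pure hk)

lemma runs_skip (s : Tuple) : Runs [.skip] s 1 (PMF.pure s) := Runs.of_step rfl (runs_nil 0 s)

lemma runs_push (r : ℕ) (b : Bool) (s : Tuple) :
    Runs [.push r b] s 1 (PMF.pure (Function.update s r (b :: s r))) :=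
  Runs.of_step rfl (runs_nil 0 _)

lemma runs_pop (r : ℕ) (s : Tuple) :
    Runs [.pop r] s 1 (PMF.pure (Function.update s r (s r).tail)) :=
  Runs.of_step rfl (runs_nil 0 _)

lemma runs_loop_nil {r : ℕ} {a : Instr} {s : Tuple} (h : s r = []) :
    Runs [.loop r a] s 1 (PMF.pure s) :=
  Runs.of_step (l' := []) (s' := s) (by simp [step, h]) (runs_nil 0 s)

lemma runs_loop_cons {r : ℕ} {a : Instr} {s s' : Tuple} {T T' : ℕ} {D : PMF Tuple} (h : s r ≠ [])
    (ha : Runs [a] s T (PMF.pure s')) (hl : Runs [.loop r a] s' T' D) :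
    Runs [.loop r a] s (T + T' + 1) D :=
  Runs.of_step (l' := [a, .loop r a]) (s' := s) (by simp [step, h]) (ha.cons_pure hl)

/-! ## Moving bits -/

/-- Empty register `r`, executing `f b` for each bit `b` that is removed. -/
def drain (r : ℕ) (f : Bool → Instr) : Instr :=
  .loop r (.case r .skip (.seq (.pop r) (f true)) (.seq (.pop r) (f false)))

/-- The overhead of 4 per bit is the loop test, the case distinction, the unfolding of `seq` and the
`pop`. -/
lemma runs_drain_cons {r : ℕ} {f : Bool → Instr} {s s' : Tuple} {b : Bool} {x : List Bool}
    {T T' : ℕ} {D : PMF Tuple} (h : s r = b :: x)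
    (hf : Runs [f b] (Function.update s r x) T (PMF.pure s')) (hl : Runs [drain r f] s' T' D) :
    Runs [drain r f] s (T + T' + 4) D := by
  have h1 : Runs [.seq (.pop r) (f b)] s (1 + T + 1) (PMF.pure s') := by
    refine (runs_pop r s).seq_pure ?_
    simpa [h] using hf
  have h2 : Runs [.case r .skip (.seq (.pop r) (f true)) (.seq (.pop r) (f false))] s
      (1 + T + 1 + 1) (PMF.pure s') := by
    refine Runs.of_step (l' := [.seq (.pop r) (f b)]) (s' := s) ?_ h1
    cases b <;> simp [step, h]
  exact (runs_loop_cons (by simp [h]) h2 hl).mono (by omega)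

/-- Empty a register. -/
def clear (r : ℕ) : Instr := drain r fun _ => .skip

lemma runs_clear (r : ℕ) (s : Tuple) :
    Runs [clear r] s (5 * (s r).length + 1) (PMF.pure (Function.update s r [])) := by
  generalize hx : s r = x
  induction x generalizing s with
  | nil =>
    rw [← hx, Function.update_eq_self]
    exact (runs_loop_nil hx).mono (by omega)
  | cons b x ih =>
    have h := ih (Function.update s r x) (by simp)
    rw [Function.update_idem] at h
    exact (runs_drain_cons hx (runs_skip _) h).mono (by simp only [List.length_cons]; omega)

/-- Move the contents of register `a` to register `b`, in reversed order. -/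
def move (a b : ℕ) : Instr := drain a fun x => .push b x

lemma runs_move {a b : ℕ} (hab : a ≠ b) (s : Tuple) :
    Runs [move a b] s (5 * (s a).length + 1)
      (PMF.pure (Function.update (Function.update s a []) b ((s a).reverse ++ s b))) := by
  generalize hx : s a = x
  induction x generalizing s with
  | nil =>
    have h : Function.update s a [] = s := hx ▸ Function.update_eq_self a s
    rw [h, List.reverse_nil, List.nil_append, Function.update_eq_self]
    exact (runs_loop_nil hx).mono (by omega)
  | cons c x ih =>
    have h := ih (Function.update (Function.update s a x) b (c :: s b)) (by simp [hab])
    have e : Function.update (Function.update (Function.update (Function.update s a x) b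
        (c :: s b)) a []) b (x.reverse ++ Function.update (Function.update s a x) b (c :: s b) b) =
        Function.update (Function.update s a []) b ((c :: x).reverse ++ s b) := by
      funext j
      by_cases h1 : j = b
      · subst h1; simp
      · by_cases h2 : j = a
        · subst h2; simp [h1]
        · simp [h1, h2]
    rw [e] at h
    refine (runs_drain_cons hx (T := 1) ?_ h).mono (by simp only [List.length_cons]; omega)
    have := runs_push b c (Function.update s a x)
    rwa [Function.update_of_ne hab.symm] at this

/-- Move the contents of register `t` to the registers `a` and `b`, in reversed order. -/
def split (t a b : ℕ) : Instr := drain t fun x => .seq (.push a x) (.push b x)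

lemma runs_split {t a b : ℕ} (hta : t ≠ a) (htb : t ≠ b) (hab : a ≠ b) (s : Tuple) :
    Runs [split t a b] s (7 * (s t).length + 1)
      (PMF.pure (Function.update (Function.update (Function.update s t [])
        a ((s t).reverse ++ s a)) b ((s t).reverse ++ s b))) := by
  generalize hx : s t = x
  induction x generalizing s with
  | nil =>
    have h : Function.update s t [] = s := hx ▸ Function.update_eq_self t s
    rw [h, List.reverse_nil, List.nil_append, List.nil_append, Function.update_eq_self,
      Function.update_eq_self]
    exact (runs_loop_nil hx).mono (by omega)
  | cons c x ih =>
    have h := ih (Function.update (Function.update (Function.update s t x) a (c :: s a)) b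
      (c :: s b)) (by simp [hta, htb])
    have e : ∀ s₁, s₁ = Function.update (Function.update (Function.update s t x) a (c :: s a)) b
        (c :: s b) → Function.update (Function.update (Function.update s₁ t [])
          a (x.reverse ++ s₁ a)) b (x.reverse ++ s₁ b) =
        Function.update (Function.update (Function.update s t []) a ((c :: x).reverse ++ s a)) b
          ((c :: x).reverse ++ s b) := by
      rintro _ rfl
      funext j
      by_cases h1 : j = b
      · subst h1; simp
      · by_cases h2 : j = a
        · subst h2; simp [h1]
        · by_cases h3 : j = t
          · subst h3; simp [h1, h2]
          · simp [h1, h2, h3]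
    rw [e _ rfl] at h
    refine (runs_drain_cons hx (T := 3) ?_ h).mono (by simp only [List.length_cons]; omega)
    have h1 := runs_push a c (Function.update s t x)
    rw [Function.update_of_ne hta.symm] at h1
    have h2 := runs_push b c (Function.update (Function.update s t x) a (c :: s a))
    rw [Function.update_of_ne hab.symm, Function.update_of_ne htb.symm] at h2
    exact h1.seq_pure h2

/-- Copy register `a` to the empty register `b`, using the empty register `t`. -/
def copy (a b t : ℕ) : Instr := .seq (move a t) (split t a b)

/-- The reversals by `move` and by `split` cancel, so `a` is restored and `t` ends up empty again.
-/
lemma runs_copy {a b t : ℕ} (hta : t ≠ a) (htb : t ≠ b) (hab : a ≠ b) {s : Tuple} (hb : s b = [])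
    (ht : s t = []) :
    Runs [copy a b t] s (12 * (s a).length + 3) (PMF.pure (Function.update s b (s a))) := by
  have h1 := runs_move hta.symm s
  have h2 := runs_split hta htb hab
    (Function.update (Function.update s a []) t ((s a).reverse ++ s t))
  have e : ∀ s₁, s₁ = Function.update (Function.update s a []) t ((s a).reverse ++ s t) →
      Function.update (Function.update (Function.update s₁ t []) a ((s₁ t).reverse ++ s₁ a)) b
        ((s₁ t).reverse ++ s₁ b) = Function.update s b (s a) := by
    rintro _ rfl
    funext j
    by_cases e₁ : j = b
    · subst e₁; simp [ht, hb, htb.symm, hab.symm]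
    · by_cases e₂ : j = a
      · subst e₂; simp [e₁, ht, hta.symm]
      · by_cases e₃ : j = t
        · subst e₃; simp [e₁, e₂, ht]
        · simp [e₁, e₂, e₃]
  rw [e _ rfl] at h2
  refine (h1.seq_pure h2).mono ?_
  simp only [Function.update_self, ht, List.append_nil, List.length_reverse]
  omega

/-! ## Renaming of registers -/

/-- Relocates an algorithm to other registers, so that it can serve as a subroutine. -/
def Instr.rename (ρ : ℕ → ℕ) : Instr → Instr
  | .skip => .skip
  | .push r b => .push (ρ r) b
  | .pop r => .pop (ρ r)
  | .flip r => .flip (ρ r)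
  | .seq a b => .seq (a.rename ρ) (b.rename ρ)
  | .case r a b c => .case (ρ r) (a.rename ρ) (b.rename ρ) (c.rename ρ)
  | .loop r a => .loop (ρ r) (a.rename ρ)

/-- `Function.extend ρ s z` places the subroutine's registers `s` along `ρ` and keeps the caller's
registers `z` elsewhere. -/
lemma update_extend {ρ : ℕ → ℕ} (hρ : ρ.Injective) (s z : Tuple) (r : ℕ) (x : List Bool) :
    Function.update (Function.extend ρ s z) (ρ r) x =
      Function.extend ρ (Function.update s r x) z := by
  funext j
  by_cases h : ∃ i, ρ i = j
  · obtain ⟨i, rfl⟩ := h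
    by_cases e : i = r
    · subst e; simp [hρ.extend_apply]
    · rw [Function.update_of_ne (hρ.ne e), hρ.extend_apply, hρ.extend_apply,
        Function.update_of_ne e]
  · have e : j ≠ ρ r := fun k => h ⟨r, k.symm⟩
    rw [Function.update_of_ne e, Function.extend_apply' _ _ _ h, Function.extend_apply' _ _ _ h]

lemma step_rename {ρ : ℕ → ℕ} (hρ : ρ.Injective) (z : Tuple) (l : List Instr) (s : Tuple) :
    step (l.map (Instr.rename ρ), Function.extend ρ s z) =
      (step (l, s)).map fun c => (c.1.map (Instr.rename ρ), Function.extend ρ c.2 z) := by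
  cases l with
  | nil => simp [step, PMF.pure_map]
  | cons i l =>
    cases i with
    | flip r =>
      simp only [List.map_cons, Instr.rename, step, PMF.map_comp, hρ.extend_apply,
        update_extend hρ]
      rfl
    | case r a b c =>
      simp only [List.map_cons, Instr.rename, step, PMF.pure_map, hρ.extend_apply]
      rcases s r with _ | ⟨_ | _, _⟩ <;> rfl
    | loop r a =>
      simp only [List.map_cons, Instr.rename, step, PMF.pure_map, hρ.extend_apply]
      split_ifs <;> rfl
    | _ => simp [Instr.rename, step, PMF.pure_map, hρ.extend_apply, update_extend hρ]

lemma runSteps_rename {ρ : ℕ → ℕ} (hρ : ρ.Injective) (z : Tuple) (T : ℕ) (c : Config) :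
    runSteps T (c.1.map (Instr.rename ρ), Function.extend ρ c.2 z) =
      (runSteps T c).map fun c => (c.1.map (Instr.rename ρ), Function.extend ρ c.2 z) := by
  induction T generalizing c with
  | zero => simp [runSteps, PMF.pure_map]
  | succ T ih =>
    rw [runSteps, runSteps, step_rename hρ, PMF.bind_map, PMF.map_bind]
    congr 1
    funext c'
    exact ih c'

lemma Runs.rename {i : Instr} {s : Tuple} {T : ℕ} {D : PMF Tuple} (h : Runs [i] s T D)
    {ρ : ℕ → ℕ} (hρ : ρ.Injective) {z : Tuple} (hz : ∀ j, z (ρ j) = s j) :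
    Runs [i.rename ρ] z T (D.map fun t => Function.extend ρ t z) := by
  have hz' : Function.extend ρ s z = z := by
    funext j
    by_cases k : ∃ i, ρ i = j
    · obtain ⟨i, rfl⟩ := k
      rw [hρ.extend_apply, hz]
    · rw [Function.extend_apply' _ _ _ k]
  have := runSteps_rename hρ z T ([i], s)
  rw [hz', h, PMF.map_comp] at this
  rw [Runs, PMF.map_comp]
  exact this

/-! ## The registers that a program uses -/

/-- A strict bound of the registers that a program uses. -/
def Instr.bound : Instr → ℕ
  | .skip => 0
  | .push r _ => r + 1
  | .pop r => r + 1
  | .flip r => r + 1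
  | .seq a b => max a.bound b.bound
  | .case r a b c => max (r + 1) (max a.bound (max b.bound c.bound))
  | .loop r a => max (r + 1) a.bound

lemma step_bound {K : ℕ} {c c' : Config} (hK : ∀ i ∈ c.1, i.bound ≤ K)
    (h : c' ∈ (step c).support) : (∀ i ∈ c'.1, i.bound ≤ K) ∧ ∀ j, K ≤ j → c'.2 j = c.2 j := by
  obtain ⟨l, s⟩ := c
  cases l with
  | nil =>
    rw [step, PMF.mem_support_pure_iff] at h
    subst h
    exact ⟨hK, fun _ _ => rfl⟩
  | cons i l =>
    obtain ⟨hi, hl⟩ := List.forall_mem_cons.1 hK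
    cases i with
    | flip r =>
      rw [step, PMF.mem_support_map_iff] at h
      obtain ⟨b, _, rfl⟩ := h
      simp only [Instr.bound] at hi
      exact ⟨hl, fun j hj => Function.update_of_ne (by omega) _ _⟩
    | case r a b c =>
      rw [step, PMF.mem_support_pure_iff] at h
      subst h
      simp only [Instr.bound, max_le_iff] at hi
      refine ⟨List.forall_mem_cons.2 ⟨?_, hl⟩, fun _ _ => rfl⟩
      rcases s r with _ | ⟨_ | _, _⟩
      exacts [hi.2.1, hi.2.2.2, hi.2.2.1]
    | loop r a =>
      rw [step, PMF.mem_support_pure_iff] at h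
      subst h
      refine ⟨?_, fun _ _ => rfl⟩
      simp only [Instr.bound, max_le_iff] at hi
      dsimp only
      split_ifs
      · exact hl
      · simp only [List.forall_mem_cons, Instr.bound, max_le_iff]
        exact ⟨hi.2, hi, hl⟩
    | seq a b =>
      rw [step, PMF.mem_support_pure_iff] at h
      subst h
      simp only [Instr.bound, max_le_iff] at hi
      exact ⟨List.forall_mem_cons.2 ⟨hi.1, List.forall_mem_cons.2 ⟨hi.2, hl⟩⟩, fun _ _ => rfl⟩
    | skip =>
      rw [step, PMF.mem_support_pure_iff] at h
      subst h
      exact ⟨hl, fun _ _ => rfl⟩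
    | _ =>
      rw [step, PMF.mem_support_pure_iff] at h
      subst h
      simp only [Instr.bound] at hi
      exact ⟨hl, fun j hj => Function.update_of_ne (by omega) _ _⟩

lemma runSteps_bound {K T : ℕ} {c c' : Config} (hK : ∀ i ∈ c.1, i.bound ≤ K)
    (h : c' ∈ (runSteps T c).support) : ∀ j, K ≤ j → c'.2 j = c.2 j := by
  induction T generalizing c with
  | zero =>
    rw [runSteps, PMF.mem_support_pure_iff] at h
    exact fun j _ => by rw [h]
  | succ T ih =>
    rw [runSteps, PMF.mem_support_bind_iff] at h
    obtain ⟨c₁, h₁, h⟩ := h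
    obtain ⟨hb, hj⟩ := step_bound hK h₁
    exact fun j k => (ih hb h j k).trans (hj j k)

/-- Guarantees a supply of empty registers after a given algorithm has run. -/
lemma Runs.eq_of_bound_le {i : Instr} {s s' : Tuple} {T j : ℕ} {D : PMF Tuple}
    (h : Runs [i] s T D) (hs : s' ∈ D.support) (hj : i.bound ≤ j) : s' j = s j := by
  rw [← h.map_snd, PMF.mem_support_map_iff] at hs
  obtain ⟨c, hc, rfl⟩ := hs
  exact runSteps_bound (c := ([i], s)) (by simp) hc j hj

end

section

/-! ## Compilation of expressions and programs -/

/-- The memory that is held by the registers. -/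
def view (Δ : Env) (s : Tuple) : Mem := Mem.restrict Δ fun r => s (r + 2)

lemma view_congr {Δ : Env} {s t : Tuple} (h : ∀ r, (Δ.ty r).isSome → t (r + 2) = s (r + 2)) :
    view Δ t = view Δ s := by
  funext r
  unfold view Mem.restrict
  split_ifs with hr
  · exact h r hr
  · rfl

lemma view_apply {Δ : Env} {r : ℕ} (hr : (Δ.ty r).isSome) (s : Tuple) :
    view Δ s r = s (r + 2) := by
  simp [view, Mem.restrict, hr]

lemma length_of_view_mem {Δ : Env} {r : ℕ} {τ : Ty} (hr : Δ.ty r = some τ) {n : ℕ} {s : Tuple}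
    (hs : view Δ s ∈ Δ.mems n) : (s (r + 2)).length = τ.len n := by
  have h := hs.1 r τ hr
  rwa [view_apply (by simp [hr])] at h

/-- The length of the values of a type, as a polynomial. -/
def Ty.lenPoly : Ty → Polynomial ℕ
  | .str p => p
  | .bool => 1

lemma Ty.eval_lenPoly (τ : Ty) (n : ℕ) : τ.lenPoly.eval n = τ.len n := by
  cases τ <;> simp [Ty.lenPoly, Ty.len]

/-- Allows `choose!` to extend output distributions by junk values where no run is guaranteed. -/
instance : Nonempty (PMF Tuple) := ⟨PMF.pure fun _ => []⟩

/-- A layout of the registers: the variables `r ∈ dom Δ` are held by the registers `r + 2`, the size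
parameter is held in unary by the register `clock`, and the registers from `base` on are used for
intermediate results. -/
structure Layout (Δ : Env) where
  clock : ℕ
  base : ℕ
  clock_lt : clock < base
  var_lt : ∀ r : ℕ, (Δ.ty r).isSome → r + 2 < base
  var_ne : ∀ r : ℕ, (Δ.ty r).isSome → r + 2 ≠ clock

namespace Layout

variable {Δ : Env} (L : Layout Δ)

/-- The registers hold the size parameter and a memory; those from `B` on are unused. -/
structure Ready (B n : ℕ) (s : Tuple) : Prop where
  clock : s L.clock = List.replicate n true
  mem : view Δ s ∈ Δ.mems n
  fresh : ∀ j, B ≤ j → s j = []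

variable {L}

lemma view_eq {s t : Tuple} (h : ∀ j, j < L.base → t j = s j) : view Δ t = view Δ s :=
  view_congr fun r hr => h _ (L.var_lt r hr)

lemma Ready.of_eq {B B' n : ℕ} {s t : Tuple} (hs : L.Ready B n s)
    (h : ∀ j, j < L.base → t j = s j) (hf : ∀ j, B' ≤ j → t j = []) : L.Ready B' n t :=
  ⟨(h _ L.clock_lt).trans hs.clock, by rw [view_eq h]; exact hs.mem, hf⟩

lemma Ready.mono {B B' n : ℕ} {s : Tuple} (hs : L.Ready B n s) (h : B ≤ B') : L.Ready B' n s :=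
  ⟨hs.clock, hs.mem, fun j hj => hs.fresh j (h.trans hj)⟩

variable (L)

/-- The values `v n m` can be computed in polynomial time in any unused register. -/
def Computes (v : ℕ → Mem → PMF (List Bool)) : Prop :=
  ∀ dest B, L.base ≤ dest → dest < B →
    ∃ (i : Instr) (B' : ℕ) (q : Polynomial ℕ), B ≤ B' ∧ ∀ n s, L.Ready B n s → s dest = [] →
      ∃ D, Runs [i] s (q.eval n) D ∧ (D.map fun t => t dest) = v n (view Δ s) ∧
        ∀ t ∈ D.support, (∀ j, j < B → j ≠ dest → t j = s j) ∧ ∀ j, B' ≤ j → t j = []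

lemma computes_var {r : ℕ} {τ : Ty} (hr : Δ.ty r = some τ) :
    L.Computes fun _ m => PMF.pure (m r) := by
  intro dest B hd hB
  have hr' : (Δ.ty r).isSome := by simp [hr]
  have hlt := L.var_lt r hr'
  refine ⟨copy (r + 2) dest B, B, 12 * τ.lenPoly + 3, le_rfl, fun n s hs h0 =>
    ⟨PMF.pure (Function.update s dest (s (r + 2))), ?_, ?_, ?_⟩⟩
  · refine (runs_copy (by omega) (by omega) (by omega) h0 (hs.fresh B le_rfl)).mono ?_
    simp [Ty.eval_lenPoly, length_of_view_mem hr hs.mem]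
  · rw [PMF.pure_map, Function.update_self]
    exact congrArg PMF.pure (view_apply hr' s).symm
  · intro t ht
    rw [PMF.mem_support_pure_iff] at ht
    subst ht
    exact ⟨fun j _ hj => Function.update_of_ne hj _ _, fun j hj => by
      rw [Function.update_of_ne (by omega)]
      exact hs.fresh j hj⟩

/-- The values are computed one after the other. No evaluation disturbs the memory or earlier
results, so each value is drawn independently of the previous ones, which gives the product
distribution. -/
lemma computes_pi {k : ℕ} {v : Fin k → ℕ → Mem → PMF (List Bool)} (hv : ∀ i, L.Computes (v i))
    (dest : Fin k → ℕ) (hdest : dest.Injective) (B : ℕ) (hd : ∀ i, L.base ≤ dest i)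
    (hB : ∀ i, dest i < B) :
    ∃ (i : Instr) (B' : ℕ) (q : Polynomial ℕ), B ≤ B' ∧
      ∀ n s, L.Ready B n s → (∀ i, s (dest i) = []) →
      ∃ D, Runs [i] s (q.eval n) D ∧
        (D.map fun t i => t (dest i)) = pmfPi (fun i => v i n (view Δ s)) ∧
        ∀ t ∈ D.support, (∀ j, j < B → (∀ i, j ≠ dest i) → t j = s j) ∧ ∀ j, B' ≤ j → t j = [] := by
  induction k generalizing B with
  | zero =>
    refine ⟨.skip, B, 1, le_rfl, fun n s hs _ => ⟨PMF.pure s, ?_, ?_, ?_⟩⟩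
    · simpa using runs_skip s
    · rw [PMF.pure_map, pmfPi]
      congr 1
      exact Subsingleton.elim _ _
    · intro t ht
      rw [PMF.mem_support_pure_iff] at ht
      subst ht
      exact ⟨fun _ _ _ => rfl, hs.fresh⟩
  | succ k ih =>
    obtain ⟨i₁, B₁, q₁, hB₁, h₁⟩ := hv 0 (dest 0) B (hd 0) (hB 0)
    -- Scratch registers are not cleaned up: later evaluations start at `B₁`, above those used by
    -- the first.
    obtain ⟨i₂, B₂, q₂, hB₂, h₂⟩ := ih (fun i => hv i.succ) (fun i => dest i.succ)
      (hdest.comp (Fin.succ_injective k)) B₁ (fun i => hd i.succ) fun i => (hB i.succ).trans_le hB₁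
    refine ⟨.seq i₁ i₂, B₂, q₁ + q₂ + 1, hB₁.trans hB₂, fun n s hs h0 => ?_⟩
    obtain ⟨D, hD, hDv, hDf⟩ := h₁ n s hs (h0 0)
    have hbase : ∀ t ∈ D.support, ∀ j, j < L.base → t j = s j := fun t ht j hj =>
      (hDf t ht).1 j (by have := hd 0; have := hB 0; omega) (by have := hd 0; omega)
    have h₂' := fun t ht => h₂ n t (hs.of_eq (hbase t ht) (hDf t ht).2) fun i => by
      rw [(hDf t ht).1 _ (hB i.succ) (hdest.ne (Fin.succ_ne_zero i))]
      exact h0 i.succ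
    choose! F hF hFv hFf using h₂'
    refine ⟨D.bind F, ?_, ?_, ?_⟩
    · simpa using hD.seq hF
    · rw [pmfPi, PMF.map_bind, ← hDv, PMF.bind_map]
      refine bind_congr_support _ fun t ht => ?_
      have e := hFv t ht
      rw [view_eq (hbase t ht)] at e
      rw [Function.comp_apply, ← e, PMF.bind_map]
      change PMF.map _ _ = PMF.map (fun u : Tuple =>
        (Fin.cons (t (dest 0)) fun i => u (dest i.succ) : Fin (k + 1) → List Bool)) _
      refine map_congr_support _ fun u hu => ?_
      funext i
      refine Fin.cases ?_ (fun i => ?_) i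
      · exact (hFf t ht u hu).1 _ ((hB 0).trans_le hB₁) fun i => hdest.ne (Fin.succ_ne_zero i).symm
      · rfl
    · intro u hu
      rw [PMF.mem_support_bind_iff] at hu
      obtain ⟨t, ht, hu⟩ := hu
      refine ⟨fun j hj hne => ?_, (hFf t ht u hu).2⟩
      rw [(hFf t ht u hu).1 j (hj.trans_le hB₁) fun i => hne i.succ]
      exact (hDf t ht).1 j hj (hne 0)

/-- The arguments and a copy of the clock are laid out as a renamed input of `A`, which then runs as
a subroutine with output register `dest`. -/
lemma computes_app {k : ℕ} {σ : Fin k → Ty} (A : PPT pad (args σ))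
    {F : ℕ → (Fin k → List Bool) → PMF (List Bool)} (hF : ∀ n, ∀ a ∈ args σ n, A.value n a = F n a)
    {v : Fin k → ℕ → Mem → PMF (List Bool)} (hv : ∀ i, L.Computes (v i))
    (hσ : ∀ i n, ∀ m ∈ Δ.mems n, (v i n m).support ⊆ (σ i).den n) :
    L.Computes fun n m => (pmfPi fun i => v i n m).bind (F n) := by
  intro dest B hd hB
  -- `K` exceeds every register that `A` touches or that carries its input.
  obtain ⟨K, hK, hkK⟩ : ∃ K, A.prog.bound ≤ K ∧ k + 2 ≤ K :=
    ⟨max A.prog.bound (k + 2), le_max_left _ _, le_max_right _ _⟩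
  obtain ⟨i₀, B₁, q, hB₁, h⟩ := L.computes_pi hv (fun i => B + 2 + i)
    (fun i j hij => Fin.ext (by simpa using hij)) (B + K) (fun i => by omega) fun i => by omega
  have hclock := L.clock_lt
  -- The working registers of `A` go to the block below `B + K`; the infinitely many others must
  -- also appear empty to `A`, so they go beyond all used scratch space. Register `B` itself is not
  -- in the range and serves as temporary for `copy`.
  let ρ : ℕ → ℕ := fun j => if j = 0 then dest else if j < K then B + j else B₁ + j
  have hρ : ρ.Injective := by
    intro x y hxy
    simp only [ρ] at hxy
    split_ifs at hxy <;> omega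
  refine ⟨.seq i₀ (.seq (copy L.clock (B + 1) B) (A.prog.rename ρ)), B₁ + K,
    q + (12 * .X + 3 + A.time + 1) + 1, by omega, fun n s hs h0 => ?_⟩
  obtain ⟨D, hD, hDv, hDf⟩ := h n s (hs.mono (by omega)) fun i => hs.fresh _ (by omega)
  let a : Tuple → Fin k → List Bool := fun t i => t (B + 2 + i)
  have ha : ∀ t ∈ D.support, a t ∈ args σ n := by
    intro t ht i
    have : a t ∈ (D.map a).support := (PMF.mem_support_map_iff _ _ _).2 ⟨t, ht, rfl⟩
    rw [show D.map a = _ from hDv] at this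
    exact hσ i n _ hs.mem (mem_support_of_mem_support_pmfPi this i)
  let u : Tuple → Tuple := fun t => Function.update t (B + 1) (List.replicate n true)
  have hts : ∀ t ∈ D.support, ∀ j, j < B + 2 → t j = s j := fun t ht j hj =>
    (hDf t ht).1 j (by omega) fun i => by omega
  have hcopy : ∀ t ∈ D.support,
      Runs [copy L.clock (B + 1) B] t (12 * n + 3) (PMF.pure (u t)) := by
    intro t ht
    have hc : t L.clock = List.replicate n true := by rw [hts t ht _ (by omega), hs.clock]
    have := runs_copy (a := L.clock) (b := B + 1) (t := B) (s := t) (by omega) (by omega) (by omega)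
      (by rw [hts t ht _ (by omega)]; exact hs.fresh _ (by omega))
      (by rw [hts t ht _ (by omega)]; exact hs.fresh _ (by omega))
    rwa [hc, List.length_replicate] at this
  have hu : ∀ t ∈ D.support, ∀ j, u t (ρ j) = initRegs n (pad (a t)) j := by
    intro t ht j
    match j with
    | 0 =>
      simp only [ρ, u, initRegs, if_true]
      rw [Function.update_of_ne (by omega), hts t ht _ (by omega), h0]
    | 1 =>
      have : 1 < K := by omega
      simp [ρ, u, initRegs, this]
    | j + 2 =>
      simp only [ρ, u, initRegs, pad, a]
      rw [if_neg (by omega), Function.update_of_ne (by split_ifs <;> omega)]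
      by_cases hj : j < k
      · rw [if_pos (by omega), dif_pos hj]
        congr 1
        omega
      · rw [dif_neg hj]
        split_ifs with hjK
        · rw [(hDf t ht).1 _ (by omega) fun i => by have := i.2; omega]
          exact hs.fresh _ (by omega)
        · exact (hDf t ht).2 _ (by omega)
  have hrun : ∀ t ∈ D.support, Runs [A.prog.rename ρ] (u t) (A.time.eval n)
      ((A.out n (a t)).map fun x => Function.extend ρ x (u t)) := fun t ht =>
    (A.runs (ha t ht)).rename hρ (hu t ht)
  refine ⟨D.bind fun t => (A.out n (a t)).map fun x => Function.extend ρ x (u t), ?_, ?_, ?_⟩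
  · simpa using hD.seq fun t ht => (hcopy t ht).seq_pure (hrun t ht)
  · dsimp only
    rw [← hDv, PMF.bind_map, PMF.map_bind]
    refine bind_congr_support _ fun t ht => ?_
    rw [Function.comp_apply, ← hF n _ (ha t ht), PMF.map_comp]
    change _ = PMF.map _ _
    congr 1
    funext x
    exact hρ.extend_apply x (u t) 0
  · intro y hy
    simp only [PMF.mem_support_bind_iff, PMF.mem_support_map_iff] at hy
    obtain ⟨t, ht, x, hx, rfl⟩ := hy
    refine ⟨fun j hj hne => ?_, fun j hj => ?_⟩
    · rw [Function.extend_apply']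
      · simp only [u]
        rw [Function.update_of_ne (by omega)]
        exact hts t ht j (by omega)
      · rintro ⟨i, hi⟩
        simp only [ρ] at hi
        split_ifs at hi <;> omega
    -- These registers are images of indices at least `K`, which `A` never touches.
    · obtain ⟨i, rfl⟩ : ∃ i, j = B₁ + i := ⟨j - B₁, by omega⟩
      have e : ρ i = B₁ + i := by
        simp only [ρ]
        rw [if_neg (by omega), if_neg (by omega)]
      rw [← e, hρ.extend_apply, (A.runs (ha t ht)).eq_of_bound_le hx (by omega), ← hu t ht i, e]
      simp only [u]
      rw [Function.update_of_ne (by omega)]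
      exact (hDf t ht).2 _ (by omega)

variable {S : Signature}

lemma computes_dExpr {d : DExpr S} {τ : Ty} (hd : d.HasType Δ τ) :
    L.Computes fun n m => PMF.pure (d.val n m) := by
  induction hd with
  | var hr => exact L.computes_var hr
  | @app g d hd ih =>
    obtain ⟨A, _, hA⟩ := S.dFun_poly g
    have := L.computes_app A hA ih fun i n m hm => by
      rw [PMF.support_pure]
      exact Set.singleton_subset_iff.2 ((hd i).val_mem hm)
    simpa only [pmfPi_pure, PMF.pure_bind, DExpr.val] using this

lemma computes_expr {e : Expr S} {τ : Ty} (he : e.HasType Δ τ) : L.Computes e.val := by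
  induction he with
  | det hd => exact L.computes_dExpr hd
  | @app f e he ih =>
    obtain ⟨A, hA⟩ := S.rFun_poly f
    exact L.computes_app A hA ih fun i n m hm => (he i).support_val_subset hm

/-- A register that holds neither a variable nor an intermediate result. -/
def Idle (j : ℕ) : Prop := j < L.base ∧ ∀ r : ℕ, (Δ.ty r).isSome → j ≠ r + 2

/-- Every program can be executed in polynomial time on the registers. -/
theorem exists_implementation {P : Prog S} (hP : P.Typed Δ) (B : ℕ) (hB : L.base ≤ B) :
    ∃ (i : Instr) (B' : ℕ) (q : Polynomial ℕ), B ≤ B' ∧ ∀ n s, L.Ready B n s →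
      ∃ D, Runs [i] s (q.eval n) D ∧ D.map (view Δ) = P.semN n (PMF.pure (view Δ s)) ∧
        ∀ t ∈ D.support, L.Ready B' n t ∧ ∀ j, L.Idle j → t j = s j := by
  induction hP generalizing B with
  | skip =>
    refine ⟨.skip, B, 1, le_rfl, fun n s hs => ⟨PMF.pure s, ?_, ?_, ?_⟩⟩
    · simpa using runs_skip s
    · rw [PMF.pure_map, Prog.semN]
    · intro t ht
      rw [PMF.mem_support_pure_iff] at ht
      subst ht
      exact ⟨hs, fun _ _ => rfl⟩
  | @assign r e τ hr he =>
    have hr' : (Δ.ty r).isSome := by simp [hr]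
    have hlt := L.var_lt r hr'
    have hclock := L.clock_lt
    -- The value goes to the temporary `B` first, since the expression may read the old value of
    -- `r`.
    obtain ⟨i, B₁, q, hB₁, h⟩ := L.computes_expr he B (B + 1) hB (by omega)
    refine ⟨.seq i (.seq (clear (r + 2)) (copy B (r + 2) B₁)), B₁,
      q + (5 * τ.lenPoly + 1 + (12 * τ.lenPoly + 3) + 1) + 1, by omega, fun n s hs => ?_⟩
    obtain ⟨D, hD, hDv, hDf⟩ := h n s (hs.mono (by omega)) (hs.fresh B le_rfl)
    have hts : ∀ t ∈ D.support, ∀ j, j < L.base → t j = s j := fun t ht j hj =>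
      (hDf t ht).1 j (by omega) (by omega)
    have htB : ∀ t ∈ D.support, t B ∈ τ.den n := by
      intro t ht
      refine he.support_val_subset hs.mem ?_
      rw [← hDv]
      exact (PMF.mem_support_map_iff _ _ _).2 ⟨t, ht, rfl⟩
    have hrun : ∀ t ∈ D.support, Runs [.seq (clear (r + 2)) (copy B (r + 2) B₁)] t
        (5 * τ.len n + 1 + (12 * τ.len n + 3) + 1)
        (PMF.pure (Function.update t (r + 2) (t B))) := by
      intro t ht
      have h1 := runs_clear (r + 2) t
      rw [hts t ht _ hlt, length_of_view_mem hr hs.mem] at h1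
      have h2 := runs_copy (a := B) (b := r + 2) (t := B₁) (s := Function.update t (r + 2) [])
        (by omega) (by omega) (by omega) (by simp)
        (by rw [Function.update_of_ne (by omega)]; exact (hDf t ht).2 _ le_rfl)
      rw [Function.update_of_ne (by omega), Function.update_idem,
        show (t B).length = τ.len n from htB t ht] at h2
      exact h1.seq_pure h2
    have hview : ∀ t ∈ D.support, view Δ (Function.update t (r + 2) (t B)) =
        Function.update (view Δ s) r (t B) := by
      intro t ht
      funext r'
      by_cases e : r' = r
      · subst e
        rw [view_apply hr', Function.update_self, Function.update_self]
      · rw [Function.update_of_ne e, ← view_eq (hts t ht)]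
        simp only [view, Mem.restrict]
        rw [Function.update_of_ne fun k => e (Nat.add_right_cancel k)]
    refine ⟨D.bind fun t => PMF.pure (Function.update t (r + 2) (t B)), ?_, ?_, ?_⟩
    · simpa [Ty.eval_lenPoly] using hD.seq hrun
    · rw [Prog.semN, PMF.pure_bind, ← hDv, PMF.bind_map, PMF.map_bind]
      refine bind_congr_support _ fun t ht => ?_
      rw [PMF.pure_map, hview t ht, Function.comp_apply]
    · intro y hy
      simp only [PMF.mem_support_bind_iff, PMF.mem_support_pure_iff] at hy
      obtain ⟨t, ht, rfl⟩ := hy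
      refine ⟨⟨?_, ?_, fun j hj => ?_⟩, fun j hj => ?_⟩
      · rw [Function.update_of_ne (L.var_ne r hr').symm, hts t ht _ hclock, hs.clock]
      · rw [hview t ht]
        exact update_mem_mems hs.mem hr (htB t ht)
      · rw [Function.update_of_ne (by omega)]
        exact (hDf t ht).2 j hj
      · rw [Function.update_of_ne (hj.2 r hr'), hts t ht j hj.1]
  | @seq P Q _ _ ih₁ ih₂ =>
    obtain ⟨i₁, B₁, q₁, hB₁, h₁⟩ := ih₁ B hB
    obtain ⟨i₂, B₂, q₂, hB₂, h₂⟩ := ih₂ B₁ (hB.trans hB₁)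
    refine ⟨.seq i₁ i₂, B₂, q₁ + q₂ + 1, hB₁.trans hB₂, fun n s hs => ?_⟩
    obtain ⟨D, hD, hDv, hDf⟩ := h₁ n s hs
    have h₂' := fun t ht => h₂ n t (hDf t ht).1
    choose! F hF hFv hFf using h₂'
    refine ⟨D.bind F, ?_, ?_, ?_⟩
    · simpa using hD.seq hF
    · rw [Prog.semN, ← hDv, Q.semN_bind, PMF.bind_map, PMF.map_bind]
      exact bind_congr_support _ hFv
    · intro u hu
      rw [PMF.mem_support_bind_iff] at hu
      obtain ⟨t, ht, hu⟩ := hu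
      exact ⟨(hFf t ht u hu).1, fun j hj => ((hFf t ht u hu).2 j hj).trans ((hDf t ht).2 j hj)⟩
  | @ite r P Q hr _ _ ih₁ ih₂ =>
    have hr' : (Δ.ty r).isSome := by simp [hr]
    obtain ⟨i₁, B₁, q₁, hB₁, h₁⟩ := ih₁ B hB
    obtain ⟨i₂, B₂, q₂, hB₂, h₂⟩ := ih₂ B hB
    -- A Boolean register holds exactly one bit, so the branch for the empty register is never
    -- taken. The sum of the two time bounds covers either branch.
    refine ⟨.case (r + 2) .skip i₁ i₂, max B₁ B₂, q₁ + q₂ + 1, hB₁.trans (le_max_left _ _),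
      fun n s hs => ?_⟩
    obtain ⟨b, hb⟩ := List.length_eq_one_iff.1
      (show (s (r + 2)).length = 1 from length_of_view_mem hr hs.mem)
    rw [Prog.semN, PMF.pure_bind, view_apply hr', hb]
    cases b with
    | true =>
      obtain ⟨D, hD, hDv, hDf⟩ := h₁ n s hs
      refine ⟨D, ?_, by simpa using hDv, fun t ht =>
        ⟨(hDf t ht).1.mono (le_max_left _ _), (hDf t ht).2⟩⟩
      refine (Runs.of_step (l' := [i₁]) (s' := s) (by simp [step, hb]) hD).mono ?_
      simp
    | false =>
      obtain ⟨D, hD, hDv, hDf⟩ := h₂ n s hs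
      refine ⟨D, ?_, by simpa using hDv, fun t ht =>
        ⟨(hDf t ht).1.mono (le_max_right _ _), (hDf t ht).2⟩⟩
      refine (Runs.of_step (l' := [i₂]) (s' := s) (by simp [step, hb]) hD).mono ?_
      simp

end Layout

end

section

/-! ## Programs act on stores and preserve indistinguishability -/

lemma Env.exists_bound (Δ : Env) : ∃ b : ℕ, ∀ r : ℕ, (Δ.ty r).isSome → r < b := by
  obtain ⟨b, hb⟩ := Δ.finite.bddAbove
  exact ⟨b + 1, fun r hr => Nat.lt_succ_of_le (hb (Option.isSome_iff_ne_none.1 hr))⟩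

lemma view_initRegs {Δ : Env} {n : ℕ} {m : Mem} (hm : m ∈ Δ.mems n) :
    view Δ (initRegs n m) = m :=
  restrict_eq_self hm

variable {S : Signature}

/-- The new sampler saves `1ⁿ`, runs the sampler `A` of `R`, and then runs the implementation of `P`
on the memory that `A` leaves. -/
theorem Prog.Typed.sem_mem {Δ : Env} {P : Prog S} (hP : P.Typed Δ) {R : Ensemble}
    (hR : R ∈ Δ.sem) : P.sem R ∈ Δ.sem := by
  refine ⟨fun n => hP.support_semN_subset (hR.1 n), ?_⟩
  obtain ⟨A, hA⟩ := hR.2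
  obtain ⟨b, hb⟩ := Δ.exists_bound
  -- `A` may destroy its copy of `1ⁿ` in register `1`, so a copy is kept in a register `c` above all
  -- variables and all registers of `A`.
  obtain ⟨c, hcA, hcb⟩ : ∃ c, A.prog.bound ≤ c ∧ b + 2 ≤ c :=
    ⟨max A.prog.bound (b + 2), le_max_left _ _, le_max_right _ _⟩
  have hlt : ∀ r : ℕ, (Δ.ty r).isSome → r + 2 < c := fun r hr => by have := hb r hr; omega
  let L : Layout Δ := ⟨c, c + 1, by omega, fun r hr => (hlt r hr).trans (by omega),
    fun r hr => (hlt r hr).ne⟩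
  obtain ⟨i, B', q, -, h⟩ := L.exists_implementation hP (c + 1) le_rfl
  -- The renaming skips `c`, so the saved clock is outside its range, and fixes the registers of the
  -- variables.
  let ρ : ℕ → ℕ := fun j => if j < c then j else j + 1
  have hρ : ρ.Injective := by
    intro x y hxy
    simp only [ρ] at hxy
    split_ifs at hxy <;> omega
  let s₀ : ℕ → Tuple := fun n => initRegs n fun _ => []
  have hs₀ : ∀ n j, 2 ≤ j → s₀ n j = [] := by
    intro n j hj
    obtain ⟨j, rfl⟩ := Nat.exists_eq_add_of_le' hj
    rfl
  let s₁ : ℕ → Tuple := fun n => Function.update (s₀ n) c (List.replicate n true)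
  have hcopy : ∀ n, Runs [copy 1 c (c + 1)] (s₀ n) (12 * n + 3) (PMF.pure (s₁ n)) := by
    intro n
    have := runs_copy (a := 1) (b := c) (t := c + 1) (s := s₀ n) (by omega) (by omega) (by omega)
      (hs₀ n c (by omega)) (hs₀ n (c + 1) (by omega))
    rwa [show s₀ n 1 = List.replicate n true from rfl, List.length_replicate] at this
  have hs₁ : ∀ n j, s₁ n (ρ j) = s₀ n j := by
    intro n j
    simp only [s₁, ρ]
    split_ifs with hj
    · rw [Function.update_of_ne (by omega)]
    · rw [Function.update_of_ne (by omega), hs₀ n _ (by omega), hs₀ n _ (by omega)]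
  have hArun := fun n => A.runs (n := n) (x := ()) trivial
  have hview : ∀ (z t : Tuple), view Δ (Function.extend ρ t z) = view Δ t := fun z t =>
    view_congr fun r hr => by
      have e : ρ (r + 2) = r + 2 := if_pos (hlt r hr)
      conv_lhs => rw [← e]
      exact hρ.extend_apply t z (r + 2)
  -- Whatever else `A` leaves below `c` is harmless: the layout only needs emptiness from `c + 1`
  -- on.
  have hready : ∀ n, ∀ t ∈ (A.out n ()).support,
      L.Ready (c + 1) n (Function.extend ρ t (s₁ n)) := by
    intro n t ht
    refine ⟨?_, ?_, fun j hj => ?_⟩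
    · rw [Function.extend_apply']
      · exact Function.update_self _ _ _
      · rintro ⟨j, hj⟩
        change ρ j = c at hj
        simp only [ρ] at hj
        split_ifs at hj <;> omega
    · rw [hview]
      refine hR.1 n ?_
      rw [hA n]
      exact (PMF.mem_support_map_iff _ _ _).2 ⟨t, ht, rfl⟩
    · obtain ⟨j, rfl⟩ := Nat.exists_eq_add_of_le' (show 1 ≤ j by omega)
      have e : ρ j = j + 1 := if_neg (by omega)
      rw [← e, hρ.extend_apply, (hArun n).eq_of_bound_le ht (by omega)]
      exact hs₀ n j (by omega)
  have h' : ∀ n, ∀ u ∈ ((A.out n ()).map fun t => Function.extend ρ t (s₁ n)).support, _ :=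
    fun n u hu => h n u (by
      obtain ⟨t, ht, rfl⟩ := (PMF.mem_support_map_iff _ _ _).1 hu
      exact hready n t ht)
  choose! F hF hFv _ using h'
  have hrun : ∀ n, Runs [.seq (copy 1 c (c + 1)) (.seq (A.prog.rename ρ) i)] (s₀ n)
      ((12 * .X + 3 + (A.time + q + 1) + 1 : Polynomial ℕ).eval n)
      (((A.out n ()).map fun t => Function.extend ρ t (s₁ n)).bind (F n)) := by
    intro n
    simpa using (hcopy n).seq_pure (((hArun n).rename hρ (hs₁ n)).seq (hF n))
  refine ⟨⟨_, _, fun n _ _ c hc => (hrun n).halts hc⟩, fun n => ?_⟩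
  change P.semN n (R n) = PMF.map (view Δ) _
  rw [PPT.out, (hrun n).map_snd, P.semN_bind, hA n, PMF.map_bind, PMF.bind_map, PMF.bind_map]
  refine bind_congr_support _ fun t ht => ?_
  rw [Function.comp_apply, Function.comp_apply, hFv n _ ((PMF.mem_support_map_iff _ _ _).2 ⟨t, ht, rfl⟩), hview]
  rfl

/-- A distinguisher `A` for the outputs becomes one for the inputs by running `P` first; its
advantage is exactly the same. The support hypotheses matter because the implementation is correct
only on well-typed memories. -/
theorem Prog.Typed.indist_sem {Δ : Env} {P : Prog S} (hP : P.Typed Δ) {R Q : Ensemble}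
    (hR : ∀ n, (R n).support ⊆ Δ.mems n) (hQ : ∀ n, (Q n).support ⊆ Δ.mems n)
    (h : Δ.Indist R Q) : Δ.Indist (P.sem R) (P.sem Q) := by
  intro A
  obtain ⟨b, hb⟩ := Δ.exists_bound
  let L : Layout Δ := ⟨1, b + 2, by omega, fun r hr => by have := hb r hr; omega, by omega⟩
  obtain ⟨i, B, q, hB, hi⟩ := L.exists_implementation hP (b + 2) le_rfl
  have hnone : ∀ j : ℕ, ¬ (Δ.ty j).isSome → Δ.ty j = none := fun j hj => by simpa using hj
  -- Output, clock and variables stay in place; all other registers of `A` are sent beyond the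
  -- scratch space of `P`.
  let ρ : ℕ → ℕ := fun j => if j < b + 2 then j else B + j
  have hρ : ρ.Injective := by
    intro x y hxy
    simp only [ρ] at hxy
    split_ifs at hxy <;> omega
  have hready : ∀ n, ∀ m ∈ Δ.mems n, L.Ready (b + 2) n (initRegs n m) := by
    refine fun n m hm => ⟨rfl, by rwa [view_initRegs hm], fun j hj => ?_⟩
    obtain ⟨j, rfl⟩ := Nat.exists_eq_add_of_le' (show 2 ≤ j by omega)
    exact hm.2 j (hnone j fun k => by have := hb j k; omega)
  have hi' := fun n m hm => hi n _ (hready n m hm)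
  choose! D hD hDv hDf using hi'
  -- After `P`, the registers seen through `ρ` form a genuine initial configuration for `A`.
  -- Idleness keeps register `0` and the gaps between variables empty.
  have hregs : ∀ n, ∀ m ∈ Δ.mems n, ∀ t ∈ (D n m).support, ∀ j,
      t (ρ j) = initRegs n (view Δ t) j := by
    intro n m hm t ht j
    obtain ⟨hr, hidle⟩ := hDf n m hm t ht
    match j with
    | 0 => exact hidle 0 ⟨by simp [L], by omega⟩
    | 1 => exact hr.clock
    | j + 2 =>
      simp only [ρ, initRegs]
      split_ifs with hj
      · by_cases hj' : (Δ.ty j).isSome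
        · rw [view_apply hj']
        · rw [hr.mem.2 j (hnone j hj'), hidle (j + 2) ⟨hj, fun r hr' e => hj' ?_⟩]
          · exact hm.2 j (hnone j hj')
          · rwa [Nat.add_right_cancel e]
      · rw [hr.mem.2 j (hnone j fun k => by have := hb j k; omega)]
        exact hr.fresh _ (by omega)
  have hrun : ∀ n, ∀ m ∈ Δ.mems n, Runs [.seq i (A.prog.rename ρ)] (initRegs n m)
      ((q + A.time + 1).eval n)
      ((D n m).bind fun t => (A.out n (view Δ t)).map fun x => Function.extend ρ x t) := by
    intro n m hm
    simpa using (hD n m hm).seq fun t ht =>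
      (A.runs (hDf n m hm t ht).1.mem).rename hρ (hregs n m hm t ht)
  let A' : PPT (fun m : Mem => m) Δ.mems :=
    ⟨.seq i (A.prog.rename ρ), q + A.time + 1, fun n m hm c hc => (hrun n m hm).halts hc⟩
  have hA' : ∀ n, ∀ m ∈ Δ.mems n,
      A'.value n m = (P.semN n (PMF.pure m)).bind (A.value n) := by
    intro n m hm
    have e := hDv n m hm
    rw [view_initRegs hm] at e
    rw [PPT.value, PPT.out, (hrun n m hm).map_snd, ← e, PMF.bind_map, PMF.map_bind]
    congr 1
    funext t
    rw [PMF.map_comp]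
    change PMF.map _ _ = PMF.map _ _
    congr 1
    funext x
    exact hρ.extend_apply x t 0
  have hsem : ∀ {R : Ensemble}, (∀ n, (R n).support ⊆ Δ.mems n) → ∀ n,
      (P.sem R n).bind (A.value n) = (R n).bind (A'.value n) := by
    intro R hR n
    rw [Prog.sem, P.semN_bind, PMF.bind_bind]
    exact bind_congr_support _ fun m hm => (hA' n m (hR n hm)).symm
  obtain ⟨ν, hν, hνn⟩ := h A'
  refine ⟨ν, hν, fun n => ?_⟩
  rw [hsem hR, hsem hQ]
  exact hνn n

/-! ## Soundness of the structural rules -/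

variable {Δ Ξ Θ : Env} {P : Prog S}

theorem Valid.weak {φ ψ ξ η : Formula S Δ} (h : Valid ξ P η) (hφ : φ.Entails ξ)
    (hψ : η.Entails ψ) : Valid φ P ψ :=
  ⟨h.1, fun R hR hs =>
    have k := h.2 R hR (hφ R hR hs)
    ⟨k.1, hψ _ k.1 k.2⟩⟩

theorem Valid.const {φ ψ : Formula S Ξ} {ξ : Formula S Θ} (h : Valid φ P ψ)
    (hm : Θ.dom ∩ P.mv = ∅) (hΞ : Ξ ≤ Δ) (hΘ : Θ ≤ Δ) :
    Valid (.conj φ ξ hΞ hΘ : Formula S Δ) P (.conj ψ ξ hΞ hΘ) := by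
  refine ⟨h.1.mono hΞ, fun R hR hs => ⟨(h.1.mono hΞ).sem_mem hR, ?_⟩⟩
  obtain ⟨Q, hQ, T, hT, ⟨_, rfl⟩, ⟨_, rfl⟩, hφ, hξ⟩ := hs
  obtain ⟨hQ', hψ⟩ := h.2 _ hQ hφ
  -- The first witness is transformed by `P`; the second is kept as it is.
  exact ⟨_, hQ', _, hT, ⟨hΞ, (h.1.proj_sem R).symm⟩,
    ⟨hΘ, (Prog.proj_sem_of_disjoint_mv hm R).symm⟩, hψ, hξ⟩

theorem Valid.frame {φ ψ : Formula S Ξ} {ξ : Formula S Θ} (h : Valid φ P ψ)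
    (hd : Disjoint Ξ.dom Θ.dom) (hj : Ξ.join Θ ≤ Δ) :
    Valid (.sep φ ξ hd hj : Formula S Δ) P (.sep ψ ξ hd hj) := by
  have hP := h.1.mono (Ξ.left_le_join Θ)
  refine ⟨hP.mono hj, fun R hR hs => ⟨(hP.mono hj).sem_mem hR, ?_⟩⟩
  obtain ⟨Q, hQ, T, hT, U, hU, hI, ⟨_, rfl⟩, hφ, hξ⟩ := hs
  obtain ⟨hQ', hψ⟩ := h.2 _ hQ hφ
  refine ⟨_, hQ', _, hT, _, hP.sem_mem hU, ?_, ⟨hj, (hP.proj_sem R).symm⟩, hψ, hξ⟩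
  -- Running `P` on the first factor is exactly running it on the product, so the given
  -- indistinguishability can be pushed through `P`.
  rw [h.1.tensor_sem]
  exact hP.indist_sem (fun n => tensor_support_subset (hQ.1 n) (hT.1 n)) hU.1 hI

/-- Both formulas are evaluated on projections to `Ξ`, with which `P` commutes. -/
theorem Valid.restr {φ ψ : Formula S Ξ} {φ' ψ' : Formula S Δ} (h : Valid φ P ψ)
    (hφ : φ.Ext φ') (hψ : ψ.Ext ψ') : Valid φ' P ψ' := by
  refine ⟨h.1.mono hφ.le, fun R hR hs => ?_⟩
  have hR' := (h.1.mono hφ.le).sem_mem hR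
  refine ⟨hR', (hψ.sat_iff hR').2 ?_⟩
  rw [h.1.proj_sem]
  exact (h.2 _ (proj_mem_sem hφ.le hR) ((hφ.sat_iff hR).1 hs)).2

end

end CSL

end

theorem mainTheorem4 (S : CSL.Signature) :
    -- Weak
    (∀ (Δ : CSL.Env) (P : CSL.Prog S) (φ ψ ξ η : CSL.Formula S Δ),
      CSL.Valid ξ P η → φ.Entails ξ → η.Entails ψ → CSL.Valid φ P ψ) ∧
    -- Const
    (∀ (Ξ Θ Δ : CSL.Env) (P : CSL.Prog S) (φ ψ : CSL.Formula S Ξ) (ξ : CSL.Formula S Θ)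
      (hΞ : Ξ ≤ Δ) (hΘ : Θ ≤ Δ),
      CSL.Valid φ P ψ → Θ.dom ∩ P.mv = ∅ →
        CSL.Valid (.conj φ ξ hΞ hΘ : CSL.Formula S Δ) P (.conj ψ ξ hΞ hΘ)) ∧
    -- Frame
    (∀ (Ξ Θ Δ : CSL.Env) (P : CSL.Prog S) (φ ψ : CSL.Formula S Ξ) (ξ : CSL.Formula S Θ)
      (hd : Disjoint Ξ.dom Θ.dom) (hj : Ξ.join Θ ≤ Δ),
      CSL.Valid φ P ψ →
        CSL.Valid (.sep φ ξ hd hj : CSL.Formula S Δ) P (.sep ψ ξ hd hj)) ∧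
    -- Restr
    (∀ (Ξ Δ : CSL.Env) (P : CSL.Prog S) (φ ψ : CSL.Formula S Ξ) (φ' ψ' : CSL.Formula S Δ),
      CSL.Valid φ P ψ → φ.Ext φ' → ψ.Ext ψ' → CSL.Valid φ' P ψ') := by
  refine ⟨?_, ?_, ?_, ?_⟩
  · exact fun Δ P φ ψ ξ η h hφ hψ => h.weak hφ hψ
  · exact fun Ξ Θ Δ P φ ψ ξ hΞ hΘ h hm => h.const hm hΞ hΘ
  · exact fun Ξ Θ Δ P φ ψ ξ hd hj h => h.frame hd hj
  · exact fun Ξ Δ P φ ψ φ' ψ' h hφ hψ => h.restr hφ hψ
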